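/- Let $X_1,X_2$ be non-singular complex varieties, that is, non-empty smooth separated schemes of finite type over $\mathbb C$ (not necessarily irreducible), and let $D_1,D_2$ be effective Cartier divisors on $X_1,X_2$. For an affine open $U=\mathrm{Spec}\,A$ of a non-singular complex variety and a nonzerodivisor $f\in A$, let $D(A)\subseteq \mathrm{End}_{\mathbb C}(A)$ be the algebra of differential operators, generated by $A$ and $\mathrm{Der}_{\mathbb C}(A)$. Let $D(A)[s]$ act on the free $A_f[s]$-module $A_f[s]\cdot f^s$ by $a\,(c f^s)=(ac) f^s$ for $a\in A[s]$ and $\delta(c f^s)=\bigl(\delta(c)+s\,c\,\tfrac{\delta(f)}{f}\bigr)f^s$ for $\delta\in\mathrm{Der}_{\mathbb C}(A)$, and put $f^{s+1}=f\cdot f^s$. The Bernstein-Sato polynomial $b_f(s)$ is the monic polynomial of least degree among the nonzero $b\in\mathbb C[s]$ with $b(s) f^s\in D(A)[s]\cdot f^{s+1}$. For an effective Cartier divisor $D$, its Bernstein-Sato polynomial $b_D(s)$ is the monic least common multiple of the $b_f(s)$, over all affine opens $U$ and all $f\in\Gamma(U,\mathcal O)$ with $D|_U=\mathrm{div}(f)$.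 Let $D_1\otimes D_2$ be the effective Cartier divisor on $X_1\times_{\mathbb C} X_2$ represented by $f\otimes g$ on $U\times V$ whenever $U\subseteq X_1$, $V\subseteq X_2$ are affine opens on which $D_1$, $D_2$ are represented by $f$, $g$. Then $$b_{D_1\otimes D_2}(s)=b_{D_1}(s)\cdot b_{D_2}(s).$$ -/

import Mathlib

open CategoryTheory CategoryTheory.Limits AlgebraicGeometry Polynomial

universe u

namespace BernsteinSato

noncomputable section

section Algebra

variable {A : Type u} [CommRing A] [Algebra ℂ A]

/-- The unique extension to `A_f` of a `ℂ`-derivation `δ` of `A` (quotient rule). -/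
def localizedDerivation (f : A) (δ : Derivation ℂ A A) :
    Derivation ℂ (Localization.Away f) (Localization.Away f) :=
  haveI : Algebra.FormallyEtale A (Localization.Away f) :=
    Algebra.FormallyEtale.of_isLocalization (Submonoid.powers f)
  ((LinearMap.liftBaseChange (Localization.Away f)
      (Algebra.linearMap A (Localization.Away f) ∘ₗ δ.liftKaehlerDifferential)) ∘ₗ
    (KaehlerDifferential.tensorKaehlerEquivOfFormallyEtale ℂ A
      (Localization.Away f)).symm.toLinearMap).compDer
    (KaehlerDifferential.D ℂ (Localization.Away f))

theorem localizedDerivation_algebraMap (f : A) (δ : Derivation ℂ A A) (a : A) :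
    localizedDerivation f δ (algebraMap A (Localization.Away f) a) =
      algebraMap A (Localization.Away f) (δ a) := by
  have : Algebra.FormallyEtale A (Localization.Away f) :=
    Algebra.FormallyEtale.of_isLocalization (Submonoid.powers f)
  simp [localizedDerivation,
    KaehlerDifferential.tensorKaehlerEquivOfFormallyEtale_symm_D_algebraMap]

/-- The action of a derivation `δ` of `A` on the module `A_f[s] · f^s`. An element `c · f^s` is
recorded as the polynomial `c ∈ A_f[s]` (the variable `X` is `s`), and
`δ (c · f^s) = (δ(c) + s · c · δ(f) / f) · f^s`, where `δ` acts on `A_f[s]` coefficientwise. -/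
def derivationAction (f : A) (δ : Derivation ℂ A A) :
    Module.End ℂ (Localization.Away f)[X] :=
  (Polynomial.lsum fun n =>
      (Polynomial.monomial n).restrictScalars ℂ ∘ₗ (localizedDerivation f δ).toLinearMap) +
    LinearMap.mulLeft ℂ (X * C (algebraMap A (Localization.Away f) (δ f) *
      IsLocalization.Away.invSelf f))

/-- The ring of operators through which `D(A)[s]` acts on `A_f[s] · f^s`. Since `D(A)`, the ring of
differential operators of the regular algebra `A`, is generated by `A` and the `ℂ`-derivations
of `A`, this is the ring generated by multiplications by elements of `A[s]` and by the actions
of the derivations. -/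
def operators (f : A) : Subalgebra ℂ (Module.End ℂ (Localization.Away f)[X]) :=
  Algebra.adjoin ℂ
    (Set.range (fun p : A[X] =>
        LinearMap.mulLeft ℂ (p.map (algebraMap A (Localization.Away f)))) ∪
      Set.range (derivationAction f))

theorem mulLeft_mem_operators (f : A) (c : ℂ[X]) :
    LinearMap.mulLeft ℂ (c.map (algebraMap ℂ (Localization.Away f))) ∈ operators f := by
  refine Algebra.subset_adjoin (Or.inl ⟨c.map (algebraMap ℂ A), ?_⟩)
  simp only [Polynomial.map_map, ← IsScalarTower.algebraMap_eq]

/-- The ideal of all `b ∈ ℂ[s]` with `b(s) · f^s ∈ D(A)[s] · f^(s+1)`, that is, such that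
`P · f^(s+1) = b(s) · f^s` for some `P ∈ D(A)[s]`. Here `f^(s+1) = f · f^s`. -/
def functionalIdeal (f : A) : Ideal ℂ[X] where
  carrier := {b | ∃ P ∈ operators f, P (C (algebraMap A (Localization.Away f) f)) =
    b.map (algebraMap ℂ (Localization.Away f))}
  zero_mem' := ⟨0, zero_mem _, by simp⟩
  add_mem' := by
    rintro a b ⟨P, hP, hP'⟩ ⟨Q, hQ, hQ'⟩
    exact ⟨P + Q, add_mem hP hQ, by simp [hP', hQ']⟩
  smul_mem' := by
    rintro c b ⟨P, hP, hP'⟩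
    exact ⟨_, mul_mem (mulLeft_mem_operators f c) hP, by simp [hP']⟩

/-- The Bernstein-Sato polynomial `b_f(s)`: the monic polynomial of least degree among the nonzero
`b` with `b(s) · f^s ∈ D(A)[s] · f^(s+1)`, i.e. the monic generator of the ideal of all such `b`. -/
def bernsteinSatoPolynomial (f : A) : ℂ[X] :=
  normalize (Submodule.IsPrincipal.generator (functionalIdeal f))

theorem bernsteinSatoPolynomial_dvd_iff (f : A) (c : ℂ[X]) :
    bernsteinSatoPolynomial f ∣ c ↔ c ∈ functionalIdeal f := by
  rw [bernsteinSatoPolynomial, normalize_dvd_iff, ← Submodule.IsPrincipal.mem_iff_generator_dvd]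

end Algebra

section PullbackOfIdeals

theorem ideal_comap_top {X Y : Scheme.{u}} [IsAffine X] [IsAffine Y]
    (J : Y.IdealSheafData) (f : X ⟶ Y) :
    (J.comap f).ideal ⟨⊤, isAffineOpen_top X⟩ =
      (J.ideal ⟨⊤, isAffineOpen_top Y⟩).map f.appTop.hom := by
  have key : ∀ K : X.IdealSheafData, J.comap f ≤ K ↔
      (J.ideal ⟨⊤, isAffineOpen_top Y⟩).map f.appTop.hom ≤ K.ideal ⟨⊤, isAffineOpen_top X⟩ := by
    intro K
    rw [← Scheme.IdealSheafData.le_map_iff_comap_le, Ideal.map_le_iff_le_comap]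
    have h := Scheme.IdealSheafData.ideal_map_of_isAffineHom K f ⟨⊤, isAffineOpen_top Y⟩
    constructor
    · intro H
      exact (H _).trans h.le
    · intro H
      exact Scheme.IdealSheafData.le_of_isAffine (H.trans h.ge)
  apply le_antisymm
  · have := (key (Scheme.IdealSheafData.ofIdealTop
      ((J.ideal ⟨⊤, isAffineOpen_top Y⟩).map f.appTop.hom))).2 (by simp)
    simpa using this ⟨⊤, isAffineOpen_top X⟩
  · exact (key _).1 le_rfl

theorem ideal_comap_ι_top {X : Scheme.{u}} (I : X.IdealSheafData) (U : X.affineOpens)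
    [IsAffine U.1] :
    (I.comap U.1.ι).ideal ⟨⊤, isAffineOpen_top _⟩ =
      (I.ideal U).map U.1.topIso.inv.hom := by
  rw [Scheme.IdealSheafData.ideal_comap_of_isOpenImmersion, Scheme.Opens.ι_appIso]
  have h := Scheme.IdealSheafData.map_ideal' I
    (U := ⟨U.1.ι ''ᵁ ⊤, (isAffineOpen_top U.1.toScheme).image_of_isOpenImmersion U.1.ι⟩) (V := U)
    (eqToHom U.1.ι_image_top).op
  refine Eq.trans ?_ h.symm
  exact Ideal.comap_id _

theorem ideal_comap {X Y : Scheme.{u}} (f : X ⟶ Y) (I : Y.IdealSheafData)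
    (U : Y.affineOpens) (W : X.affineOpens) (e : W.1 ≤ f ⁻¹ᵁ U.1) :
    (I.comap f).ideal W = (I.ideal U).map (f.appLE U.1 W.1 e).hom := by
  have : IsAffine U.1 := U.2
  have : IsAffine W.1 := W.2
  have h := ideal_comap_ι_top (I.comap f) W
  rw [← Scheme.IdealSheafData.comap_comp, ← Scheme.Hom.resLE_comp_ι f e,
    Scheme.IdealSheafData.comap_comp, ideal_comap_top, ideal_comap_ι_top, Ideal.map_map,
    ← CommRingCat.hom_comp, Scheme.Hom.appTop, Scheme.Hom.resLE_app_top,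
    Iso.inv_hom_id_assoc] at h
  have h2 := congrArg (Ideal.map W.1.topIso.hom.hom) h
  rw [Ideal.map_map, Ideal.map_map, ← CommRingCat.hom_comp, ← CommRingCat.hom_comp,
    Category.assoc, Iso.inv_hom_id, Category.comp_id, CommRingCat.hom_id, Ideal.map_id] at h2
  exact h2.symm

end PullbackOfIdeals

section Divisors

/-- An effective Cartier divisor on `X`: a (quasi-coherent) ideal sheaf which is locally generated
by one nonzerodivisor. -/
structure EffectiveCartierDivisor (X : Scheme.{u}) where
  /-- The ideal sheaf `𝒪_X(-D)`. -/
  idealSheaf : X.IdealSheafData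
  exists_isLocalEquation : ∀ x : X, ∃ U : X.affineOpens, x ∈ U.1 ∧
    ∃ f ∈ nonZeroDivisors Γ(X, U.1), idealSheaf.ideal U = Ideal.span {f}

/-- `D|_U = div(f)`: the divisor `D` is represented by `f` on the affine open `U`. -/
def EffectiveCartierDivisor.IsLocalEquation {X : Scheme.{u}} (D : EffectiveCartierDivisor X)
    (U : X.affineOpens) (f : Γ(X, U.1)) : Prop :=
  f ∈ nonZeroDivisors Γ(X, U.1) ∧ D.idealSheaf.ideal U = Ideal.span {f}

/-- The `ℂ`-algebra structure of the ring of sections of a `ℂ`-scheme. -/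
abbrev sectionsAlgebra {X : Scheme.{0}} (p : X ⟶ Spec (.of ℂ)) (U : X.Opens) :
    Algebra ℂ Γ(X, U) :=
  ((Scheme.ΓSpecIso (.of ℂ)).inv ≫ p.appLE ⊤ U le_top).hom.toAlgebra

/-- The Bernstein-Sato polynomial of an effective Cartier divisor `D` on a `ℂ`-scheme `X`:
the (monic) least common multiple of all `b_f(s)`, over all affine opens `U` of `X` on which `D` is
represented by one function `f`. These `U` form an affine open covering of `X`. -/
def EffectiveCartierDivisor.bernsteinSatoPolynomial {X : Scheme.{0}} (p : X ⟶ Spec (.of ℂ))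
    (D : EffectiveCartierDivisor X) : ℂ[X] :=
  normalize (Submodule.IsPrincipal.generator
    (⨅ (U : X.affineOpens) (f : Γ(X, U.1)) (_ : D.IsLocalEquation U f),
      Ideal.span {letI := sectionsAlgebra p U.1; BernsteinSato.bernsteinSatoPolynomial f}))

theorem EffectiveCartierDivisor.bernsteinSatoPolynomial_dvd_iff {X : Scheme.{0}}
    (p : X ⟶ Spec (.of ℂ)) (D : EffectiveCartierDivisor X) (c : ℂ[X]) :
    D.bernsteinSatoPolynomial p ∣ c ↔
      ∀ (U : X.affineOpens) (f : Γ(X, U.1)), D.IsLocalEquation U f →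
        (letI := sectionsAlgebra p U.1; BernsteinSato.bernsteinSatoPolynomial f) ∣ c := by
  rw [EffectiveCartierDivisor.bernsteinSatoPolynomial, normalize_dvd_iff,
    ← Submodule.IsPrincipal.mem_iff_generator_dvd]
  simp only [Submodule.mem_iInf, Ideal.mem_span_singleton]

theorem appLE_mem_nonZeroDivisors {X Y : Scheme.{u}} (p : X ⟶ Y) [Flat p]
    (U : Y.affineOpens) (W : X.affineOpens) (e : W.1 ≤ p ⁻¹ᵁ U.1) {f : Γ(Y, U.1)}
    (hf : f ∈ nonZeroDivisors Γ(Y, U.1)) :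
    (p.appLE U.1 W.1 e).hom f ∈ nonZeroDivisors Γ(X, W.1) := by
  have h : (p.appLE U.1 W.1 e).hom.Flat := Flat.flat_appLE p U.2 W.2 e
  algebraize [(p.appLE U.1 W.1 e).hom]
  have h1 : IsSMulRegular Γ(X, W.1) f := Module.Flat.isSMulRegular_of_nonZeroDivisors hf
  rw [mem_nonZeroDivisors_iff_right]
  intro x hx
  refine h1.right_eq_zero_of_smul ?_
  rw [Algebra.smul_def, mul_comm]
  exact hx

theorem flat_of_spec {X : Scheme.{0}} (p : X ⟶ Spec (.of ℂ)) : Flat p := by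
  have : Subsingleton (Spec (.of ℂ)) := inferInstanceAs (Subsingleton (PrimeSpectrum ℂ))
  infer_instance

variable {X₁ X₂ : Scheme.{0}} (p₁ : X₁ ⟶ Spec (.of ℂ)) (p₂ : X₂ ⟶ Spec (.of ℂ))

/-- The ideal sheaf on `X₁ × X₂` generated by the products of the pullbacks of local sections of
two ideal sheaves. -/
def tensorIdeal (I₁ : X₁.IdealSheafData) (I₂ : X₂.IdealSheafData) :
    (pullback p₁ p₂).IdealSheafData :=
  I₁.comap (pullback.fst p₁ p₂) * I₂.comap (pullback.snd p₁ p₂)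

theorem tensorIdeal_local (D₁ : EffectiveCartierDivisor X₁) (D₂ : EffectiveCartierDivisor X₂)
    {U : X₁.affineOpens} {V : X₂.affineOpens} {f : Γ(X₁, U.1)} {g : Γ(X₂, V.1)}
    (hf : D₁.IsLocalEquation U f) (hg : D₂.IsLocalEquation V g)
    (W : (pullback p₁ p₂).affineOpens) (hU : W.1 ≤ pullback.fst p₁ p₂ ⁻¹ᵁ U.1)
    (hV : W.1 ≤ pullback.snd p₁ p₂ ⁻¹ᵁ V.1) :
    ((pullback.fst p₁ p₂).appLE U.1 W.1 hU).hom f *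
        ((pullback.snd p₁ p₂).appLE V.1 W.1 hV).hom g ∈ nonZeroDivisors Γ(pullback p₁ p₂, W.1) ∧
      (tensorIdeal p₁ p₂ D₁.idealSheaf D₂.idealSheaf).ideal W =
        Ideal.span {((pullback.fst p₁ p₂).appLE U.1 W.1 hU).hom f *
          ((pullback.snd p₁ p₂).appLE V.1 W.1 hV).hom g} := by
  have := flat_of_spec p₁
  have := flat_of_spec p₂
  refine ⟨mul_mem (appLE_mem_nonZeroDivisors _ U W hU hf.1)
    (appLE_mem_nonZeroDivisors _ V W hV hg.1), ?_⟩
  rw [tensorIdeal, Scheme.IdealSheafData.ideal_mul, Pi.mul_apply, ideal_comap _ _ U W hU,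
    ideal_comap _ _ V W hV, hf.2, hg.2, Ideal.map_span, Ideal.map_span, Set.image_singleton,
    Set.image_singleton, Ideal.span_singleton_mul_span_singleton]

/-- The effective Cartier divisor `D₁ ⊗ D₂` on `X₁ × X₂`, where `X₁ × X₂` is the fibre product over
`Spec ℂ`. If `D₁` is represented by `f` on `U` and `D₂` by `g` on `V`, then `D₁ ⊗ D₂` is
represented on `U × V` by `f ⊗ g`, the product of the pullbacks of `f` and `g`; see
`EffectiveCartierDivisor.tensor_isLocalEquation`. -/
def EffectiveCartierDivisor.tensor (D₁ : EffectiveCartierDivisor X₁)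
    (D₂ : EffectiveCartierDivisor X₂) : EffectiveCartierDivisor (pullback p₁ p₂) where
  idealSheaf := tensorIdeal p₁ p₂ D₁.idealSheaf D₂.idealSheaf
  exists_isLocalEquation x := by
    obtain ⟨U, hxU, f, hf⟩ := D₁.exists_isLocalEquation (pullback.fst p₁ p₂ x)
    obtain ⟨V, hxV, g, hg⟩ := D₂.exists_isLocalEquation (pullback.snd p₁ p₂ x)
    obtain ⟨W, hW, hxW, hWU⟩ := TopologicalSpace.Opens.isBasis_iff_nbhd.mp
      (pullback p₁ p₂).isBasis_affineOpens
      (show x ∈ (pullback.fst p₁ p₂ ⁻¹ᵁ U.1) ⊓ (pullback.snd p₁ p₂ ⁻¹ᵁ V.1) from ⟨hxU, hxV⟩)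
    exact ⟨⟨W, hW⟩, hxW, _, tensorIdeal_local p₁ p₂ D₁ D₂ hf hg ⟨W, hW⟩
      (hWU.trans inf_le_left) (hWU.trans inf_le_right)⟩

theorem EffectiveCartierDivisor.tensor_isLocalEquation (D₁ : EffectiveCartierDivisor X₁)
    (D₂ : EffectiveCartierDivisor X₂) {U : X₁.affineOpens} {V : X₂.affineOpens}
    {f : Γ(X₁, U.1)} {g : Γ(X₂, V.1)} (hf : D₁.IsLocalEquation U f)
    (hg : D₂.IsLocalEquation V g) (W : (pullback p₁ p₂).affineOpens)
    (hW : W.1 = (pullback.fst p₁ p₂ ⁻¹ᵁ U.1) ⊓ (pullback.snd p₁ p₂ ⁻¹ᵁ V.1)) :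
    (EffectiveCartierDivisor.tensor p₁ p₂ D₁ D₂).IsLocalEquation W
      (((pullback.fst p₁ p₂).appLE U.1 W.1 (hW.trans_le inf_le_left)).hom f *
        ((pullback.snd p₁ p₂).appLE V.1 W.1 (hW.trans_le inf_le_right)).hom g) :=
  tensorIdeal_local p₁ p₂ D₁ D₂ hf hg W _ _

end Divisors

end

end BernsteinSato

/-!
The proof never uses that Bernstein-Sato polynomials are nonzero. Write `N_f ⊆ A_f[s]` for the
module `D(A)[s] · f^(s+1)` (`cyclicModule f`), so that `b_f` generates the ideal of all
`b ∈ ℂ[s]` with `b · 1 ∈ N_f`.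

*Products.* Let `T = A ⊗ B` and `h = f ⊗ g`. As the modules of Kähler differentials are finite
projective, every derivation of `T` is a `T`-linear combination of derivations of `A` and of `B`
(`span_extendedDerivations`), and a derivation of `A` acts on a product `x y`, with `x ∈ A_f[s]`
and `y ∈ B_g[s]`, through the factor `x` only (`derivationAction_mul_of_extends`). Hence `N_h` is
the image of `N_f ⊗ N_g` under the multiplication `A_f[s] ⊗ B_g[s] → T_h[s]`, which is injective
(`lift_mulAway_injective`); tensor products are over `ℂ[s]`. So `b_f b_g` belongs to the ideal
of `h`. It generates this ideal by linear algebra over the principal ideal domain `ℂ[s]`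
(`mul_dvd_of_smul_mem_map₂`): the element `b_f · 1` is not divisible in `N_f` by any prime `p`,
for if it were, then either `p ∣ b_f` and `b_f / p` would be in the ideal of `f`, or `1 ∈ A_f[s]`
would be divisible by `p`. Its class in `N_f / p N_f` is thus nonzero, likewise for `g`, and a
tensor product of nonzero vectors over the field `ℂ[s] / p` is nonzero. If `b_f` or `b_g` is zero,
contracting with a functional which maps `1` to `1` shows that the ideal of `h` is zero.

*Locality.* Passing to a localization of `A` and changing `f` by a unit `u` enlarges the ideal of
`f`, because `u^s` is an eigenvector of each derivation with eigenvalue `s δ(u) / u`. Conversely,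
derivations of `A_a` become derivations of `A` after multiplication by a power of `a`, so a
functional equation on the basic open subset of `a` gives one on `A` up to a power of `a`, and
these powers generate the unit ideal for a cover (`mem_functionalIdeal_of_span_eq_top`). Hence the
polynomial of a divisor can be computed on any affine open cover
(`EffectiveCartierDivisor.bernsteinSatoPolynomial_dvd_of_cover`), for `X₁ × X₂` on the products of
affine open subsets. The theorem follows by divisibility in both directions.
-/

namespace BernsteinSato

/-! ### Tensor products of submodules over a principal ideal domain -/

section PrincipalIdealDomain

open TensorProduct

variable {R : Type*} [CommRing R]

/-- An element not divisible by `p` in `N` is detected by a functional modulo `p`, since `N / pN` is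
a vector space over the field `R / p`. -/
theorem exists_linearMap_quotient_ne_zero {N : Type*} [AddCommGroup N] [Module R N] {p : R}
    [(Ideal.span {p}).IsMaximal] {n : N} (hn : ∀ x : N, n ≠ p • x) :
    ∃ φ : N →ₗ[R] R ⧸ Ideal.span {p}, φ n ≠ 0 := by
  let I := Ideal.span {p}
  let := Ideal.Quotient.field I
  have h0 : (Submodule.Quotient.mk n : N ⧸ (I • (⊤ : Submodule R N))) ≠ 0 := by
    rw [Ne, Submodule.Quotient.mk_eq_zero, Submodule.ideal_span_singleton_smul,
      Submodule.mem_smul_pointwise_iff_exists]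
    rintro ⟨x, -, hx⟩
    exact hn x hx.symm
  obtain ⟨ψ, hψ⟩ := Module.Projective.exists_dual_ne_zero (R ⧸ I) h0
  exact ⟨ψ.restrictScalars R ∘ₗ (Submodule.mkQ _), hψ⟩

variable [IsDomain R] {M M₁ M₂ : Type*} [AddCommGroup M] [Module R M]
  [AddCommGroup M₁] [Module R M₁] [AddCommGroup M₂] [Module R M₂]

/-- If `b` generates the ideal `(N : m)` and `m` is unimodular, then `b m` is not divisible by a prime
in `N`. -/
theorem smul_ne_of_generator {N : Submodule R M₁} {m : M₁} {φ : M₁ →ₗ[R] R} (hφ : φ m = 1)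
    [Module.IsTorsionFree R M₁] {b : R} (hb : ∀ r, r • m ∈ N ↔ b ∣ r) (hb0 : b ≠ 0)
    {p : R} (hp : Prime p) (x : M₁) (hx : x ∈ N) : b • m ≠ p • x := by
  intro h
  have hd : b = p * φ x := by simpa [hφ] using congr(φ $h)
  have hx' : φ x • m = x := by
    refine smul_right_injective M₁ hp.ne_zero ?_
    simp only
    rw [← h, smul_smul, ← hd]
  obtain ⟨c, hc⟩ := (hb (φ x)).1 (by rwa [hx'])
  have : b * 1 = b * (p * c) := by
    conv_lhs => rw [mul_one, hd, hc]
    ring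
  exact hp.not_isUnit (IsUnit.of_mul_eq_one _ (mul_left_cancel₀ hb0 this).symm)

/-- If `b₁` and `b₂` generate the ideals `(N₁ : m₁)` and `(N₂ : m₂)`, where `m₁` and `m₂` are
unimodular, then the ideal `(N₁ ⊗ N₂ : m₁ ⊗ m₂)` is contained in `(b₁ b₂)`. This includes the case
that one of the generators is zero. -/
theorem mul_dvd_of_smul_mem_map₂ [IsPrincipalIdealRing R] (β : M₁ →ₗ[R] M₂ →ₗ[R] M)
    (hβ : Function.Injective (TensorProduct.lift β))
    [Module.IsTorsionFree R M₁] [Module.IsTorsionFree R M₂]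
    {N₁ : Submodule R M₁} {N₂ : Submodule R M₂} {m₁ : M₁} {m₂ : M₂}
    {φ₁ : M₁ →ₗ[R] R} {φ₂ : M₂ →ₗ[R] R} (hφ₁ : φ₁ m₁ = 1) (hφ₂ : φ₂ m₂ = 1)
    {b₁ b₂ r : R} (hb₁ : ∀ r, r • m₁ ∈ N₁ ↔ b₁ ∣ r) (hb₂ : ∀ r, r • m₂ ∈ N₂ ↔ b₂ ∣ r)
    (hr : r • β m₁ m₂ ∈ Submodule.map₂ β N₁ N₂) : b₁ * b₂ ∣ r := by
  have himg : ∀ y ∈ Submodule.map₂ β N₁ N₂, ∃ t : N₁ ⊗[R] N₂,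
      TensorProduct.lift β (TensorProduct.map N₁.subtype N₂.subtype t) = y := by
    intro y hy
    have : Submodule.map₂ β N₁ N₂ ≤ LinearMap.range
        (TensorProduct.lift β ∘ₗ TensorProduct.map N₁.subtype N₂.subtype) :=
      Submodule.map₂_le.2 fun m hm n hn => ⟨⟨m, hm⟩ ⊗ₜ ⟨n, hn⟩, by simp⟩
    exact this hy
  have hinj : Function.Injective (TensorProduct.map N₁.subtype N₂.subtype) :=
    TensorProduct.map_injective_of_flat_flat _ _ N₁.subtype_injective N₂.subtype_injective
  obtain ⟨t, ht⟩ := himg _ hr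
  have hm : TensorProduct.map N₁.subtype N₂.subtype t = r • (m₁ ⊗ₜ m₂) :=
    hβ (by simpa using ht)
  -- Contracting with `φ₂` and `φ₁` gives the divisibilities by `b₁` and `b₂` separately; this settles
  -- the case that one of them is zero.
  have h1 : b₁ ∣ r := by
    rw [← hb₁]
    have : ∀ t : N₁ ⊗[R] N₂, (TensorProduct.rid R M₁) (φ₂.lTensor M₁
        (TensorProduct.map N₁.subtype N₂.subtype t)) ∈ N₁ := by
      intro t
      induction t with
      | zero => simp
      | add x y hx hy => simpa using add_mem hx hy
      | tmul x y => simpa using N₁.smul_mem _ x.2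
    simpa [hm, hφ₂] using this t
  have h2 : b₂ ∣ r := by
    rw [← hb₂]
    have : ∀ t : N₁ ⊗[R] N₂, (TensorProduct.lid R M₂) (φ₁.rTensor M₂
        (TensorProduct.map N₁.subtype N₂.subtype t)) ∈ N₂ := by
      intro t
      induction t with
      | zero => simp
      | add x y hx hy => simpa using add_mem hx hy
      | tmul x y => simpa using N₂.smul_mem _ y.2
    simpa [hm, hφ₁] using this t
  by_cases hr0 : r = 0
  · simp [hr0]
  have hb₁0 : b₁ ≠ 0 := fun h => hr0 (by simpa [h] using h1)
  have hb₂0 : b₂ ≠ 0 := fun h => hr0 (by simpa [h] using h2)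
  let J : Ideal R := Submodule.comap (LinearMap.toSpanSingleton R _ (m₁ ⊗ₜ[R] m₂))
    (LinearMap.range (TensorProduct.map N₁.subtype N₂.subtype))
  let n₁ : N₁ := ⟨b₁ • m₁, (hb₁ b₁).2 dvd_rfl⟩
  let n₂ : N₂ := ⟨b₂ • m₂, (hb₂ b₂).2 dvd_rfl⟩
  have hn : TensorProduct.map N₁.subtype N₂.subtype (n₁ ⊗ₜ n₂) = (b₁ * b₂) • (m₁ ⊗ₜ[R] m₂) := by
    simp [n₁, n₂, TensorProduct.smul_tmul', smul_smul, mul_comm]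
  have hrJ : r ∈ J := ⟨t, hm⟩
  have hbJ : b₁ * b₂ ∈ J := ⟨_, hn⟩
  rw [Submodule.IsPrincipal.mem_iff_generator_dvd J] at hrJ hbJ
  set c := Submodule.IsPrincipal.generator J
  obtain ⟨d, hd⟩ := hbJ
  by_cases hdu : IsUnit d
  · rw [hd]
    exact (hdu.mul_right_dvd).2 hrJ
  have hd0 : d ≠ 0 := by
    rintro rfl
    exact mul_ne_zero hb₁0 hb₂0 (by simpa using hd)
  -- Otherwise `b₁ m₁ ⊗ b₂ m₂` is divisible in `N₁ ⊗ N₂` by a prime factor `p` of `d`.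
  obtain ⟨p, hp, d', rfl⟩ := WfDvdMonoid.exists_irreducible_factor hdu hd0
  have hmax : (Ideal.span {p}).IsMaximal := PrincipalIdealRing.isMaximal_of_irreducible hp
  have hcJ : c * d' ∈ J := J.mul_mem_right _ (Submodule.IsPrincipal.generator_mem J)
  obtain ⟨t', ht'⟩ := hcJ
  have heq : n₁ ⊗ₜ[R] n₂ = p • t' := by
    apply hinj
    rw [hn, map_smul, ht', hd, LinearMap.toSpanSingleton_apply, smul_smul]
    ring_nf
  obtain ⟨ψ₁, hψ₁⟩ := exists_linearMap_quotient_ne_zero (p := p) (n := n₁) fun x hx =>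
    smul_ne_of_generator hφ₁ hb₁ hb₁0 hp.prime x x.2 congr(($hx : M₁))
  obtain ⟨ψ₂, hψ₂⟩ := exists_linearMap_quotient_ne_zero (p := p) (n := n₂) fun x hx =>
    smul_ne_of_generator hφ₂ hb₂ hb₂0 hp.prime x x.2 congr(($hx : M₂))
  have hψ := congr(LinearMap.mul' R (R ⧸ Ideal.span {p}) (TensorProduct.map ψ₁ ψ₂ $heq))
  have hp0 : algebraMap R (R ⧸ Ideal.span {p}) p = 0 :=
    Ideal.Quotient.eq_zero_iff_mem.2 (Ideal.mem_span_singleton_self p)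
  rw [map_smul, map_smul, Algebra.smul_def, hp0, zero_mul, TensorProduct.map_tmul,
    LinearMap.mul'_apply] at hψ
  exact absurd hψ (mul_ne_zero hψ₁ hψ₂)

end PrincipalIdealDomain

/-! ### Derivations -/

section Derivations

/-- Two derivations compatible on `A` are compatible on a localization of `A`. -/
theorem map_derivation_of_isLocalization {A L L' : Type*} [CommRing A] [CommRing L] [CommRing L']
    [Algebra A L] [Algebra ℂ L] [Algebra ℂ L'] (M : Submonoid A) [IsLocalization M L]
    (φ : L →+* L') (D : Derivation ℂ L L) (D' : Derivation ℂ L' L')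
    (h : ∀ a, D' (φ (algebraMap A L a)) = φ (D (algebraMap A L a))) (x : L) :
    D' (φ x) = φ (D x) := by
  obtain ⟨⟨a, s⟩, hx⟩ := IsLocalization.surj M x
  have h1 := h a
  rw [← hx, map_mul, Derivation.leibniz, Derivation.leibniz, h, map_add, smul_eq_mul, smul_eq_mul,
    smul_eq_mul, smul_eq_mul, map_mul, map_mul] at h1
  have hu : IsUnit (φ (algebraMap A L s)) := (IsLocalization.map_units L s).map φ
  exact hu.mul_left_cancel (add_left_cancel h1)

/-- If `Ω[A⁄k]` is finite projective, then `Der(A, M) = Der(A) ⊗ M`; here only surjectivity is needed. -/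
theorem exists_derivation_eq_sum {k A M : Type*} [CommRing k] [CommRing A] [Algebra k A]
    [Module.Projective A Ω[A⁄k]] [Module.Finite A Ω[A⁄k]] [AddCommGroup M] [Module A M]
    [Module k M] [IsScalarTower k A M] (d : Derivation k A M) :
    ∃ (n : ℕ) (δ : Fin n → Derivation k A A) (m : Fin n → M), ∀ a, d a = ∑ i, δ i a • m i := by
  obtain ⟨n, π, hπ⟩ := Module.Finite.exists_fin' A Ω[A⁄k]
  obtain ⟨σ, hσ⟩ := Module.projective_lifting_property π LinearMap.id hπ
  refine ⟨n, fun i => (LinearMap.proj i ∘ₗ σ).compDer (KaehlerDifferential.D k A),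
    fun i => d.liftKaehlerDifferential (π (Pi.single i 1)), fun a => ?_⟩
  have h1 : π (σ (KaehlerDifferential.D k A a)) = KaehlerDifferential.D k A a :=
    LinearMap.congr_fun hσ _
  rw [← d.liftKaehlerDifferential_comp_D, ← h1]
  conv_lhs => rw [pi_eq_sum_univ' (σ (KaehlerDifferential.D k A a))]
  simp [map_sum]

theorem derivation_sum_apply {k A M ι : Type*} [CommRing k] [CommRing A] [Algebra k A]
    [AddCommGroup M] [Module A M] [Module k M] (s : Finset ι) (δ : ι → Derivation k A M) (a : A) :
    (∑ i ∈ s, δ i) a = ∑ i ∈ s, δ i a := by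
  rw [← Derivation.coeFnAddMonoidHom_apply, map_sum, Finset.sum_apply]
  rfl

theorem exists_derivation_extension {k A A' : Type*} [CommRing k] [CommRing A] [CommRing A']
    [Algebra k A] [Algebra k A'] [Algebra A A'] [IsScalarTower k A A'] [Algebra.FormallyEtale A A']
    (δ : Derivation k A A) :
    ∃ δ' : Derivation k A' A', ∀ a, δ' (algebraMap A A' a) = algebraMap A A' (δ a) :=
  ⟨((LinearMap.liftBaseChange A' (Algebra.linearMap A A' ∘ₗ δ.liftKaehlerDifferential)) ∘ₗ
    (KaehlerDifferential.tensorKaehlerEquivOfFormallyEtale k A A').symm.toLinearMap).compDer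
    (KaehlerDifferential.D k A'), fun a => by
      simp [KaehlerDifferential.tensorKaehlerEquivOfFormallyEtale_symm_D_algebraMap]⟩

variable {L L' : Type*} [CommRing L] [Algebra ℂ L] [CommRing L'] [Algebra ℂ L']

/-- The coefficientwise extension of a derivation of `L` to `L[X]`. -/
noncomputable def coeffwise (D : Derivation ℂ L L) : L[X] →ₗ[ℂ] L[X] :=
  Polynomial.lsum fun n => (Polynomial.monomial n).restrictScalars ℂ ∘ₗ D.toLinearMap

theorem coeff_coeffwise (D : Derivation ℂ L L) (x : L[X]) (n : ℕ) :
    (coeffwise D x).coeff n = D (x.coeff n) := by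
  induction x using Polynomial.induction_on' with
  | add p q hp hq => simp [hp, hq]
  | monomial m a =>
    simp [coeffwise, Polynomial.lsum_apply, Polynomial.coeff_monomial,
      Polynomial.sum_monomial_index, apply_ite D]

theorem coeffwise_mul (D : Derivation ℂ L L) (x y : L[X]) :
    coeffwise D (x * y) = coeffwise D x * y + x * coeffwise D y := by
  ext n
  simp only [coeff_coeffwise, Polynomial.coeff_mul, Polynomial.coeff_add, map_sum,
    ← Finset.sum_add_distrib, Derivation.leibniz, smul_eq_mul]
  exact Finset.sum_congr rfl fun i _ => by ring

theorem map_coeffwise (φ : L →+* L') (D : Derivation ℂ L L) (D' : Derivation ℂ L' L')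
    (h : ∀ x, D' (φ x) = φ (D x)) (x : L[X]) :
    coeffwise D' (x.map φ) = (coeffwise D x).map φ := by
  ext n
  simp [coeff_coeffwise, h]

end Derivations

/-! ### The module generated by `f^(s+1)` -/

section CyclicModule

variable {A : Type*} [CommRing A] [Algebra ℂ A]

theorem derivationAction_apply (f : A) (δ : Derivation ℂ A A) (x : (Localization.Away f)[X]) :
    derivationAction f δ x = coeffwise (localizedDerivation f δ) x +
      X * C (algebraMap A (Localization.Away f) (δ f) * IsLocalization.Away.invSelf f) * x :=
  rfl

theorem derivationAction_mul (f : A) (δ : Derivation ℂ A A) (x y : (Localization.Away f)[X]) :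
    derivationAction f δ (x * y) =
      coeffwise (localizedDerivation f δ) x * y + x * derivationAction f δ y := by
  rw [derivationAction_apply, derivationAction_apply, coeffwise_mul]
  ring

theorem localizedDerivation_eq (f : A) (δ : Derivation ℂ A A)
    (D : Derivation ℂ (Localization.Away f) (Localization.Away f))
    (h : ∀ a, D (algebraMap A _ a) = algebraMap A _ (δ a)) : localizedDerivation f δ = D := by
  ext x
  exact (map_derivation_of_isLocalization (Submonoid.powers f) (RingHom.id _) D
    (localizedDerivation f δ) (fun a => by simp [localizedDerivation_algebraMap, h]) x)

theorem localizedDerivation_smul (f a : A) (δ : Derivation ℂ A A) :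
    localizedDerivation f (a • δ) =
      algebraMap A (Localization.Away f) a • localizedDerivation f δ :=
  localizedDerivation_eq _ _ _ fun b => by
    simp [localizedDerivation_algebraMap, Algebra.smul_def]

theorem localizedDerivation_add (f : A) (δ ε : Derivation ℂ A A) :
    localizedDerivation f (δ + ε) = localizedDerivation f δ + localizedDerivation f ε :=
  localizedDerivation_eq _ _ _ fun b => by simp [localizedDerivation_algebraMap]

theorem derivationAction_smul (f a : A) (δ : Derivation ℂ A A) (x : (Localization.Away f)[X]) :
    derivationAction f (a • δ) x =
      (C a).map (algebraMap A (Localization.Away f)) * derivationAction f δ x := by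
  have h : coeffwise (localizedDerivation f (a • δ)) x =
      (C a).map (algebraMap A (Localization.Away f)) * coeffwise (localizedDerivation f δ) x := by
    ext n
    rw [Polynomial.map_C, coeff_C_mul, coeff_coeffwise, coeff_coeffwise, localizedDerivation_smul]
    rfl
  rw [derivationAction_apply, derivationAction_apply, h, Derivation.smul_apply, smul_eq_mul,
    (algebraMap A (Localization.Away f)).map_mul, Polynomial.map_C]
  simp only [C_mul]
  ring

theorem derivationAction_add (f : A) (δ ε : Derivation ℂ A A) (x : (Localization.Away f)[X]) :
    derivationAction f (δ + ε) x = derivationAction f δ x + derivationAction f ε x := by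
  have h : coeffwise (localizedDerivation f (δ + ε)) x =
      coeffwise (localizedDerivation f δ) x + coeffwise (localizedDerivation f ε) x := by
    ext n
    rw [coeff_add, coeff_coeffwise, coeff_coeffwise, coeff_coeffwise, localizedDerivation_add]
    rfl
  rw [derivationAction_apply, derivationAction_apply, derivationAction_apply, h,
    Derivation.add_apply, map_add, add_mul, C_add]
  ring

attribute [local instance] Polynomial.algebra

/-- The `A[s]`-submodule `D(A)[s] · f^(s+1)` of `A_f[s] · f^s`. As in `derivationAction`, the element
`c · f^s` is recorded as `c ∈ A_f[s]`, so that `f^(s+1)` is the constant polynomial `f`. -/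
noncomputable def cyclicModule (f : A) : Submodule A[X] (Localization.Away f)[X] where
  carrier := {x | ∃ P ∈ operators f, P (C (algebraMap A (Localization.Away f) f)) = x}
  zero_mem' := ⟨0, zero_mem _, by simp⟩
  add_mem' := by
    rintro a b ⟨P, hP, hP'⟩ ⟨Q, hQ, hQ'⟩
    exact ⟨P + Q, add_mem hP hQ, by simp [hP', hQ']⟩
  smul_mem' := by
    rintro c b ⟨P, hP, hP'⟩
    exact ⟨_, mul_mem (Algebra.subset_adjoin (Or.inl ⟨c, rfl⟩)) hP, by
      simp [hP', Algebra.smul_def]⟩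

theorem mem_functionalIdeal_iff (f : A) (b : ℂ[X]) :
    b ∈ functionalIdeal f ↔ b.map (algebraMap ℂ (Localization.Away f)) ∈ cyclicModule f :=
  Iff.rfl

theorem C_mem_cyclicModule (f : A) :
    C (algebraMap A (Localization.Away f) f) ∈ cyclicModule f :=
  ⟨1, one_mem _, rfl⟩

theorem map_mul_mem_cyclicModule {f : A} (p : A[X]) {x : (Localization.Away f)[X]}
    (hx : x ∈ cyclicModule f) : p.map (algebraMap A (Localization.Away f)) * x ∈ cyclicModule f :=
  (cyclicModule f).smul_mem p hx

theorem derivationAction_mem_cyclicModule {f : A} (δ : Derivation ℂ A A)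
    {x : (Localization.Away f)[X]} (hx : x ∈ cyclicModule f) :
    derivationAction f δ x ∈ cyclicModule f := by
  obtain ⟨P, hP, rfl⟩ := hx
  exact ⟨_, mul_mem (Algebra.subset_adjoin (Or.inr ⟨δ, rfl⟩)) hP, rfl⟩

theorem cyclicModule_induction {f : A} {p : (Localization.Away f)[X] → Prop}
    (base : p (C (algebraMap A (Localization.Away f) f)))
    (add : ∀ x y, p x → p y → p (x + y))
    (mul : ∀ (q : A[X]) x, p x → p (q.map (algebraMap A (Localization.Away f)) * x))
    (der : ∀ δ x, p x → p (derivationAction f δ x))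
    {x : (Localization.Away f)[X]} (hx : x ∈ cyclicModule f) : p x := by
  obtain ⟨P, hP, rfl⟩ := hx
  suffices ∀ x, p x → p (P x) from this _ base
  induction hP using Algebra.adjoin_induction with
  | mem T hT =>
    rcases hT with ⟨q, rfl⟩ | ⟨δ, rfl⟩
    · exact fun x hx => mul q x hx
    · exact fun x hx => der δ x hx
  | algebraMap r =>
    intro x hx
    have := mul (C (algebraMap ℂ A r)) x hx
    rwa [Polynomial.map_C, ← IsScalarTower.algebraMap_apply, ← Polynomial.algebraMap_apply,
      ← Algebra.smul_def] at this
  | add P Q _ _ hP hQ => exact fun x hx => add _ _ (hP x hx) (hQ x hx)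
  | mul P Q _ _ hP hQ => exact fun x hx => hP _ (hQ x hx)

/-- Compatibility of the twisted actions with a change of rings `A → A'`: if `f' = f v` and
`δ'` extends `δ`, then `f'^s = f^s v^s`, and `δ'` acts on the factor `v^s` by `s δ'(v) / v`. -/
theorem derivationAction_map {A' : Type*} [CommRing A'] [Algebra ℂ A'] {f : A} {f' v w : A'}
    (ψ : A →+* A') (φ : Localization.Away f →+* Localization.Away f')
    (hφ : ∀ a, φ (algebraMap A _ a) = algebraMap A' _ (ψ a)) (hf' : f' = ψ f * v)
    (δ : Derivation ℂ A A) (δ' : Derivation ℂ A' A') (hδ : ∀ a, δ' (ψ a) = ψ (δ a))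
    (hv : δ' v = w * v) (x : (Localization.Away f)[X]) :
    derivationAction f' δ' (x.map φ) = (derivationAction f δ x).map φ +
      X * C (algebraMap A' _ w) * x.map φ := by
  have h1 : coeffwise (localizedDerivation f' δ') (x.map φ) =
      (coeffwise (localizedDerivation f δ) x).map φ :=
    map_coeffwise _ _ _ (map_derivation_of_isLocalization (Submonoid.powers f) _ _ _ fun a => by
      rw [hφ, localizedDerivation_algebraMap, localizedDerivation_algebraMap, hφ, hδ]) _
  have hu : algebraMap A' (Localization.Away f') f' * IsLocalization.Away.invSelf f' = 1 :=
    IsLocalization.Away.mul_invSelf f'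
  have hu2 :
      algebraMap A' (Localization.Away f') (ψ f) * φ (IsLocalization.Away.invSelf f) = 1 := by
    rw [← hφ, ← map_mul, IsLocalization.Away.mul_invSelf, map_one]
  have h2 : algebraMap A' (Localization.Away f') (δ' f') * IsLocalization.Away.invSelf f' =
      φ (algebraMap A (Localization.Away f) (δ f) * IsLocalization.Away.invSelf f) +
        algebraMap A' _ w := by
    have h3 : δ' f' = ψ (δ f) * v + w * f' := by
      rw [hf', Derivation.leibniz, hv, hδ, smul_eq_mul, smul_eq_mul]
      ring
    have h4 : algebraMap A' (Localization.Away f') f' =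
      algebraMap A' (Localization.Away f') (ψ f) * algebraMap A' (Localization.Away f') v := by
      rw [← map_mul, hf']
    rw [h3, map_mul, hφ, map_add, map_mul, map_mul]
    linear_combination (algebraMap A' _ w +
      algebraMap A' (Localization.Away f') (ψ (δ f)) * φ (IsLocalization.Away.invSelf f)) * hu -
      algebraMap A' (Localization.Away f') (ψ (δ f)) * algebraMap A' (Localization.Away f') v *
        IsLocalization.Away.invSelf f' * hu2 -
      algebraMap A' (Localization.Away f') (ψ (δ f)) * φ (IsLocalization.Away.invSelf f) *
        IsLocalization.Away.invSelf f' * h4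
  rw [derivationAction_apply, derivationAction_apply, h1, h2]
  simp only [Polynomial.map_add, Polynomial.map_mul, Polynomial.map_X, Polynomial.map_C, C_add]
  ring

end CyclicModule

/-! ### Localization and changing the equation by a unit -/

section Localization

variable {A A' : Type*} [CommRing A] [CommRing A']

/-- The ring homomorphism `A_f → A'_{f'}` when `f'` is a multiple of the image of `f`. -/
noncomputable def awayMap {f : A} {f' v : A'} (ψ : A →+* A') (h : f' = ψ f * v) :
    Localization.Away f →+* Localization.Away f' :=
  IsLocalization.Away.lift (g := (algebraMap A' (Localization.Away f')).comp ψ) f (by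
    have := IsLocalization.Away.algebraMap_isUnit (S := Localization.Away f') f'
    refine isUnit_of_dvd_unit ((algebraMap A' (Localization.Away f')).map_dvd ?_) this
    exact ⟨v, h⟩)

theorem awayMap_algebraMap {f : A} {f' v : A'} (ψ : A →+* A') (h : f' = ψ f * v) (a : A) :
    awayMap ψ h (algebraMap A _ a) = algebraMap A' _ (ψ a) := by
  simp [awayMap]

variable [Algebra A A'] {f : A} {f' : A'} {u : A'ˣ}

theorem exists_pow_mul_eq_zero (a : A) [IsLocalization.Away a A'] (h : f' = algebraMap A A' f * u)
    (x : Localization.Away f) (hx : awayMap (algebraMap A A') h x = 0) :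
    ∃ k, algebraMap A _ a ^ k * x = 0 := by
  obtain ⟨n, y, hy⟩ := IsLocalization.Away.surj f x
  have h1 := congr(awayMap (algebraMap A A') h $hy)
  rw [map_mul, hx, zero_mul, awayMap_algebraMap] at h1
  obtain ⟨⟨_, i, rfl⟩, hi⟩ := (IsLocalization.map_eq_zero_iff (Submonoid.powers f') _ _).1 h1.symm
  have h2 : algebraMap A A' (f ^ i * y) = 0 := by
    simp only [h, mul_pow] at hi
    rw [map_mul, map_pow]
    refine (u ^ i).isUnit.mul_right_cancel ?_
    rw [zero_mul, ← hi, Units.val_pow_eq_pow_val]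
    ring
  obtain ⟨⟨_, k, rfl⟩, hk⟩ := (IsLocalization.map_eq_zero_iff (Submonoid.powers a) _ _).1 h2
  refine ⟨k, ?_⟩
  have hu : IsUnit (algebraMap A (Localization.Away f) f) :=
    IsLocalization.Away.algebraMap_isUnit f
  refine ((hu.pow i).mul (hu.pow n)).mul_left_cancel ?_
  have h3 := congr(algebraMap A (Localization.Away f) $hk)
  simp only [map_mul, map_pow, map_zero] at h3
  rw [mul_zero, ← h3, ← hy]
  ring

theorem exists_pow_mul_polynomial_eq_zero (a : A) [IsLocalization.Away a A']
    (h : f' = algebraMap A A' f * u) (x : (Localization.Away f)[X])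
    (hx : x.map (awayMap (algebraMap A A') h) = 0) :
    ∃ k, C (algebraMap A (Localization.Away f) a) ^ k * x = 0 := by
  have h1 (n : ℕ) : ∃ k, algebraMap A _ a ^ k * x.coeff n = 0 := by
    refine exists_pow_mul_eq_zero a h _ ?_
    rw [← Polynomial.coeff_map, hx, Polynomial.coeff_zero]
  choose k hk using h1
  refine ⟨∑ n ∈ x.support, k n, ?_⟩
  ext n
  rw [← C_pow, coeff_C_mul, coeff_zero]
  by_cases hn : n ∈ x.support
  · rw [← Finset.sum_erase_add _ _ hn, pow_add, mul_assoc, hk, mul_zero]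
  · rw [Polynomial.notMem_support_iff.1 hn, mul_zero]

variable [Algebra ℂ A] [Algebra ℂ A'] [IsScalarTower ℂ A A']

theorem awayMap_algebraMap_complex {v : A'} (h : f' = algebraMap A A' f * v)
    (c : ℂ) : awayMap (algebraMap A A') h (algebraMap ℂ _ c) = algebraMap ℂ _ c := by
  rw [IsScalarTower.algebraMap_apply ℂ A, awayMap_algebraMap, ← IsScalarTower.algebraMap_apply,
    ← IsScalarTower.algebraMap_apply]

theorem derivation_unit (δ : Derivation ℂ A' A') (u : A'ˣ) : δ u = δ u * ↑u⁻¹ * u := by simp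

/-- Operators on `A` extend to the localization `A'`, so `N_f` maps to `N_{f'}`. -/
theorem map_awayMap_mem_cyclicModule [Algebra.FormallyEtale A A']
    (h : f' = algebraMap A A' f * u) {x : (Localization.Away f)[X]} (hx : x ∈ cyclicModule f) :
    x.map (awayMap (algebraMap A A') h) ∈ cyclicModule f' := by
  have key (q : A[X]) : (q.map (algebraMap A (Localization.Away f))).map
      (awayMap (algebraMap A A') h) =
        (q.map (algebraMap A A')).map (algebraMap A' (Localization.Away f')) := by
    simp only [Polynomial.map_map]
    congr 1
    ext a
    simp [awayMap_algebraMap]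
  refine cyclicModule_induction (p := fun x => x.map (awayMap (algebraMap A A') h) ∈ cyclicModule f')
    ?_ (fun x y hx hy => ?_) (fun q x hx => ?_) (fun δ x hx => ?_) hx
  · have := map_mul_mem_cyclicModule (C (↑u⁻¹ : A')) (C_mem_cyclicModule f')
    rw [Polynomial.map_C, ← C_mul, ← map_mul] at this
    rw [Polynomial.map_C, awayMap_algebraMap]
    rwa [show (↑u⁻¹ : A') * f' = algebraMap A A' f by rw [h, mul_comm, mul_assoc]; simp] at this
  · simpa using add_mem hx hy
  · rw [Polynomial.map_mul, key]
    exact map_mul_mem_cyclicModule _ hx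
  · obtain ⟨δ', hδ'⟩ := exists_derivation_extension (A' := A') δ
    have h1 := derivationAction_map (algebraMap A A') (awayMap (algebraMap A A') h)
      (awayMap_algebraMap _ h) h δ δ' hδ' (derivation_unit δ' u) x
    rw [← sub_eq_iff_eq_add] at h1
    rw [← h1]
    refine sub_mem (derivationAction_mem_cyclicModule _ hx) ?_
    have h2 := map_mul_mem_cyclicModule (X * C (δ' u * ↑u⁻¹)) hx
    rwa [Polynomial.map_mul, Polynomial.map_X, Polynomial.map_C] at h2

theorem functionalIdeal_le [Algebra.FormallyEtale A A'] (h : f' = algebraMap A A' f * u) :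
    functionalIdeal f ≤ functionalIdeal f' := by
  intro b hb
  have := map_awayMap_mem_cyclicModule h hb
  rw [Polynomial.map_map] at this
  rw [mem_functionalIdeal_iff]
  convert this using 2
  ext c
  exact (awayMap_algebraMap_complex h c).symm

/-- Every derivation of the localization `A' = A_a` becomes, after multiplication by a power of
`a`, the extension of a derivation of `A`. -/
theorem exists_pow_smul_derivation [Module.Projective A Ω[A⁄ℂ]] [Module.Finite A Ω[A⁄ℂ]] (a : A)
    [IsLocalization.Away a A'] (δ' : Derivation ℂ A' A') :
    ∃ (k : ℕ) (δ : Derivation ℂ A A), ∀ x, (algebraMap A A' a ^ k • δ') (algebraMap A A' x) =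
      algebraMap A A' (δ x) := by
  obtain ⟨n, δ, m, hm⟩ := exists_derivation_eq_sum (δ'.compAlgebraMap A)
  obtain ⟨⟨_, k, rfl⟩, hk⟩ := IsLocalization.exist_integer_multiples_of_finite
    (Submonoid.powers a) m
  choose c hc using hk
  refine ⟨k, ∑ i, c i • δ i, fun x => ?_⟩
  have := hm x
  simp only [Derivation.compAlgebraMap_apply] at this
  rw [Derivation.smul_apply, this, derivation_sum_apply, map_sum, smul_eq_mul, Finset.mul_sum]
  refine Finset.sum_congr rfl fun i _ => ?_
  rw [Derivation.smul_apply, smul_eq_mul, map_mul, hc, Algebra.smul_def, Algebra.smul_def, map_pow]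
  ring

/-- For `A' = A_a`, the module `N_{f'}` is the localization at `a` of the image of `N_f`. -/
theorem exists_pow_mul_mem_map_cyclicModule [Module.Projective A Ω[A⁄ℂ]] [Module.Finite A Ω[A⁄ℂ]]
    (a : A) [IsLocalization.Away a A'] (h : f' = algebraMap A A' f * u)
    {x : (Localization.Away f')[X]} (hx : x ∈ cyclicModule f') :
    ∃ k, ∃ y ∈ cyclicModule f, C (algebraMap A' _ (algebraMap A A' a)) ^ k * x =
      y.map (awayMap (algebraMap A A') h) := by
  set φ := awayMap (algebraMap A A') h with hφ
  set α := C (algebraMap A' (Localization.Away f') (algebraMap A A' a)) with hα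
  let p (x : (Localization.Away f')[X]) : Prop := ∃ k, ∃ y ∈ cyclicModule f, α ^ k * x = y.map φ
  have key (q : A[X]) : (q.map (algebraMap A (Localization.Away f))).map φ =
        (q.map (algebraMap A A')).map (algebraMap A' (Localization.Away f')) := by
    simp only [Polynomial.map_map]
    congr 1
    ext b
    simp [hφ, awayMap_algebraMap]
  have hmap {y} (hy : y ∈ cyclicModule f) : p (y.map φ) := ⟨0, y, hy, by simp⟩
  have hmulA (q : A[X]) {x} (hx : p x) :
      p ((q.map (algebraMap A A')).map (algebraMap A' (Localization.Away f')) * x) := by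
    obtain ⟨k, y, hy, hxy⟩ := hx
    refine ⟨k, _, map_mul_mem_cyclicModule q hy, ?_⟩
    rw [Polynomial.map_mul, key, ← hxy]
    ring
  have hα' (k : ℕ) : α ^ k = (((C a ^ k : A[X]).map (algebraMap A A')).map
      (algebraMap A' (Localization.Away f'))) := by simp [hα]
  have hsat (k : ℕ) {x} (hx : p (α ^ k * x)) : p x := by
    obtain ⟨l, y, hy, hxy⟩ := hx
    exact ⟨l + k, y, hy, by rw [← hxy]; ring⟩
  have hadd {x x'} (hx : p x) (hx' : p x') : p (x + x') := by
    obtain ⟨k, y, hy, hxy⟩ := hx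
    obtain ⟨l, z, hz, hxz⟩ := hx'
    refine hsat (k + l) ?_
    have e : α ^ (k + l) * (x + x') = α ^ l * y.map φ + α ^ k * z.map φ := by
      rw [← hxy, ← hxz]
      ring
    rw [e, hα', hα', ← key, ← key, ← Polynomial.map_mul, ← Polynomial.map_mul, ← Polynomial.map_add]
    exact hmap (add_mem (map_mul_mem_cyclicModule _ hy) (map_mul_mem_cyclicModule _ hz))
  have hmul (q : A'[X]) {x} (hx : p x) : p (q.map (algebraMap A' (Localization.Away f')) * x) := by
    induction q using Polynomial.induction_on' with
    | add q r hq hr =>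
      rw [Polynomial.map_add, add_mul]
      exact hadd hq hr
    | monomial n c =>
      obtain ⟨k, b, hb⟩ := IsLocalization.Away.surj a c
      refine hsat k ?_
      convert hmulA (monomial n b) hx using 1
      rw [Polynomial.map_monomial, Polynomial.map_monomial, Polynomial.map_monomial, ← mul_assoc,
        hα, ← C_pow, C_mul_monomial, ← hb, (algebraMap A' _).map_mul, (algebraMap A' _).map_pow,
        mul_comm (_ ^ _)]
  have hneg {x} (hx : p x) : p (-x) := by
    have h1 := hmul (-C 1) hx
    have h2 : (-C 1 : A'[X]).map (algebraMap A' (Localization.Away f')) * x = -x := by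
      rw [Polynomial.map_neg, Polynomial.map_C, map_one, C_1]
      exact neg_one_mul x
    rwa [h2] at h1
  suffices p x from this
  refine cyclicModule_induction (p := p) ?_ (fun x y hx hy => hadd hx hy)
    (fun q x hx => hmul q hx) (fun δ' x hx => ?_) hx
  · have := hmul (C (u : A')) (hmap (C_mem_cyclicModule f))
    rw [Polynomial.map_C, Polynomial.map_C, hφ, awayMap_algebraMap, ← C_mul, ← map_mul] at this
    rwa [mul_comm, ← h] at this
  · obtain ⟨k, y, hy, hxy⟩ := id hx
    obtain ⟨K, δ, hδ⟩ := exists_pow_smul_derivation (A := A) a δ'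
    have h1 := derivationAction_map (algebraMap A A') φ (awayMap_algebraMap _ h) h δ _ hδ
      (derivation_unit _ u) y
    have h2 : p (derivationAction f' (algebraMap A A' a ^ K • δ') (α ^ k * x)) := by
      rw [hxy, h1]
      refine hadd (hmap (derivationAction_mem_cyclicModule δ hy)) ?_
      convert hmul (X * C ((algebraMap A A' a ^ K • δ') u * ↑u⁻¹)) (hmap hy) using 2
      simp
    -- The Leibniz rule moves the power of `a` in front of `δ' x`, up to a multiple of `x`.
    have h3 : derivationAction f' (algebraMap A A' a ^ K • δ') (α ^ k * x) =
        α ^ K * (C (algebraMap A' (Localization.Away f') (δ' (algebraMap A A' a ^ k))) * x +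
          α ^ k * derivationAction f' δ' x) := by
      rw [derivationAction_smul, derivationAction_mul, Polynomial.map_C, map_pow, C_pow, ← hα]
      congr 3
      rw [hα, ← C_pow, ← map_pow]
      ext n
      rw [coeff_coeffwise, coeff_C, coeff_C]
      split_ifs
      · rw [localizedDerivation_algebraMap]
      · simp
    rw [h3] at h2
    refine hsat k ?_
    have h4 := hadd (hsat K h2) (hneg (hmul (C (δ' (algebraMap A A' a ^ k))) hx))
    rw [Polynomial.map_C] at h4
    convert h4 using 1
    ring

/-- The functional equation on the localization `A' = A_a` holds on `A` up to a power of `a`. -/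
theorem exists_pow_mul_mem_cyclicModule [Module.Projective A Ω[A⁄ℂ]] [Module.Finite A Ω[A⁄ℂ]]
    (a : A) [IsLocalization.Away a A'] (h : f' = algebraMap A A' f * u) {b : ℂ[X]}
    (hb : b ∈ functionalIdeal f') :
    ∃ k, C (algebraMap A (Localization.Away f) a) ^ k *
      b.map (algebraMap ℂ (Localization.Away f)) ∈ cyclicModule f := by
  obtain ⟨k, y, hy, hky⟩ := exists_pow_mul_mem_map_cyclicModule a h hb
  obtain ⟨l, hl⟩ := exists_pow_mul_polynomial_eq_zero a h
    (C (algebraMap A (Localization.Away f) a) ^ k * b.map (algebraMap ℂ (Localization.Away f)) - y)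
    (by
      rw [Polynomial.map_sub, ← hky, Polynomial.map_mul, Polynomial.map_pow, Polynomial.map_C,
        awayMap_algebraMap, Polynomial.map_map, sub_eq_zero]
      congr 2
      ext c
      exact awayMap_algebraMap_complex h c)
  refine ⟨l + k, ?_⟩
  rw [mul_sub, sub_eq_zero] at hl
  rw [pow_add, mul_assoc, hl]
  simpa using map_mul_mem_cyclicModule (C a ^ l) hy

/-- The functional equation can be checked locally. -/
theorem mem_functionalIdeal_of_span_eq_top {S : Set A} (hS : Ideal.span S = ⊤) {b : ℂ[X]}
    (h : ∀ a ∈ S, ∃ k, C (algebraMap A (Localization.Away f) a) ^ k *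
      b.map (algebraMap ℂ (Localization.Away f)) ∈ cyclicModule f) : b ∈ functionalIdeal f := by
  let J : Ideal A :=
    { carrier := {a | C (algebraMap A (Localization.Away f) a) *
        b.map (algebraMap ℂ (Localization.Away f)) ∈ cyclicModule f}
      zero_mem' := by simp
      add_mem' := fun {x y} hx hy => by simpa [add_mul] using add_mem hx hy
      smul_mem' := fun c x hx => by simpa [mul_assoc] using map_mul_mem_cyclicModule (C c) hx }
  have h1 : Ideal.span S ≤ J.radical := Ideal.span_le.2 fun a ha => by
    obtain ⟨k, hk⟩ := h a ha
    exact ⟨k, by simpa [J] using hk⟩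
  rw [hS, top_le_iff, Ideal.radical_eq_top, Ideal.eq_top_iff_one] at h1
  rw [mem_functionalIdeal_iff]
  simpa [J] using h1

end Localization

/-! ### Derivations and localizations of a tensor product -/

section Pushout

open TensorProduct

/-- A derivation of `A` extends to a derivation of `T = A ⊗ B` which is zero on `B`. -/
theorem exists_derivation_extension_of_isPushout {k A B T : Type*} [CommRing k] [CommRing A]
    [CommRing B] [CommRing T] [Algebra k A] [Algebra k B] [Algebra k T] [Algebra A T] [Algebra B T]
    [IsScalarTower k A T] [IsScalarTower k B T] [h : Algebra.IsPushout k A B T]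
    (δ : Derivation k A A) :
    ∃ δ' : Derivation k T T, (∀ a, δ' (algebraMap A T a) = algebraMap A T (δ a)) ∧
      ∀ b, δ' (algebraMap B T b) = 0 := by
  have h' : Algebra.IsPushout k B A T := h.symm
  let d : T →ₗ[B] T := h'.out.lift ((IsScalarTower.toAlgHom k A T).toLinearMap ∘ₗ δ.toLinearMap)
  have hd (a : A) : d (algebraMap A T a) = algebraMap A T (δ a) := h'.out.lift_eq _ a
  have h1 : d 1 = 0 := by rw [← map_one (algebraMap A T), hd, δ.map_one_eq_zero, map_zero]
  have hleib (x y : T) : d (x * y) = x • d y + y • d x := by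
    induction x using h'.out.inductionOn with
    | zero => simp
    | smul b x e => rw [smul_mul_assoc, map_smul, e, map_smul, smul_add, smul_assoc,
        smul_comm b y]
    | add x₁ x₂ e₁ e₂ => rw [add_mul, map_add, e₁, e₂, map_add, add_smul, smul_add]; abel
    | tmul a =>
      induction y using h'.out.inductionOn with
      | zero => simp
      | smul b y e => rw [mul_smul_comm, map_smul, e, map_smul, smul_add, smul_assoc,
          smul_comm b (_ : T)]
      | add x₁ x₂ e₁ e₂ => rw [mul_add, map_add, e₁, e₂, map_add, add_smul, smul_add]; abel
      | tmul c =>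
        simp only [AlgHom.toLinearMap_apply, IsScalarTower.coe_toAlgHom']
        rw [← map_mul, hd, hd, hd, δ.leibniz]
        simp
  refine ⟨Derivation.mk' (d.restrictScalars k) hleib, hd, fun b => ?_⟩
  change d (algebraMap B T b) = 0
  rw [Algebra.algebraMap_eq_smul_one, map_smul, h1, smul_zero]

variable {A B T : Type*} [CommRing A] [CommRing B] [CommRing T] [Algebra ℂ A] [Algebra ℂ B]
  [Algebra ℂ T] [Algebra A T] [Algebra B T] [IsScalarTower ℂ A T] [IsScalarTower ℂ B T]

variable (A B T) in
/-- The derivations of `T = A ⊗ B` which extend a derivation of `A` by zero on `B`. -/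
def extendedDerivations : Set (Derivation ℂ T T) :=
  {d | ∃ δ : Derivation ℂ A A, (∀ a, d (algebraMap A T a) = algebraMap A T (δ a)) ∧
    ∀ b, d (algebraMap B T b) = 0}

variable (A B) in
theorem exists_mem_span_extendedDerivations [Algebra.IsPushout ℂ A B T]
    [Module.Projective A Ω[A⁄ℂ]] [Module.Finite A Ω[A⁄ℂ]] (d : Derivation ℂ T T) :
    ∃ d' ∈ Submodule.span T (extendedDerivations A B T),
      (∀ a, d' (algebraMap A T a) = d (algebraMap A T a)) ∧ ∀ b, d' (algebraMap B T b) = 0 := by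
  obtain ⟨n, δ, t, ht⟩ := exists_derivation_eq_sum (d.compAlgebraMap A)
  choose δ' hA hB using fun i => exists_derivation_extension_of_isPushout (B := B) (T := T) (δ i)
  refine ⟨∑ i, t i • δ' i, sum_mem fun i _ => Submodule.smul_mem _ _
    (Submodule.subset_span ⟨δ i, hA i, hB i⟩), fun a => ?_, fun b => ?_⟩
  · have := ht a
    rw [Derivation.compAlgebraMap_apply] at this
    rw [derivation_sum_apply, this]
    refine Finset.sum_congr rfl fun i _ => ?_
    rw [Derivation.smul_apply, hA, smul_eq_mul, mul_comm]
    exact (Algebra.smul_def (δ i a) (t i)).symm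
  · rw [derivation_sum_apply]
    exact Finset.sum_eq_zero fun i _ => by rw [Derivation.smul_apply, hB, smul_zero]

/-- `Der(A ⊗ B)` is generated by the derivations of `A` and those of `B`. -/
theorem span_extendedDerivations [h : Algebra.IsPushout ℂ A B T]
    [Module.Projective A Ω[A⁄ℂ]] [Module.Finite A Ω[A⁄ℂ]]
    [Module.Projective B Ω[B⁄ℂ]] [Module.Finite B Ω[B⁄ℂ]] :
    Submodule.span T (extendedDerivations A B T ∪ extendedDerivations B A T) = ⊤ := by
  have h' : Algebra.IsPushout ℂ B A T := h.symm
  rw [eq_top_iff]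
  rintro d -
  obtain ⟨d₁, hd₁, h₁, h₁'⟩ := exists_mem_span_extendedDerivations A B d
  obtain ⟨d₂, hd₂, h₂, h₂'⟩ := exists_mem_span_extendedDerivations B A d
  suffices d = d₁ + d₂ by
    rw [this, Submodule.span_union]
    exact Submodule.add_mem_sup hd₁ hd₂
  ext x
  induction x using h'.out.inductionOn with
  | zero => simp
  | add x y hx hy => rw [map_add, map_add, hx, hy]
  | tmul a => simp [h₁, h₂']
  | smul b x hx =>
    rw [Algebra.smul_def, Derivation.leibniz, Derivation.leibniz, hx, Derivation.add_apply,
      Derivation.add_apply, h₁', h₂, zero_add]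

/-- A localization of `A ⊗ B` at `f ⊗ g` contains the tensor product of the localizations of `A` at `f`
and of `B` at `g`. -/
theorem productMap_injective_of_isLocalization {R A B T A' B' T' : Type*} [CommRing R]
    [CommRing A] [CommRing B] [CommRing T] [CommRing A'] [CommRing B'] [CommRing T']
    [Algebra R A] [Algebra R B] [Algebra R T] [Algebra A T] [Algebra B T] [IsScalarTower R A T]
    [IsScalarTower R B T] [Algebra.IsPushout R A B T]
    [Algebra R A'] [Algebra R B'] [Algebra R T'] [Algebra A A'] [Algebra B B'] [Algebra T T']
    [IsScalarTower R A A'] [IsScalarTower R B B'] [IsScalarTower R T T']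
    (f : A) (g : B)
    [IsLocalization.Away f A'] [IsLocalization.Away g B']
    [IsLocalization.Away (algebraMap A T f * algebraMap B T g) T'] (i : A' →ₐ[R] T')
    (j : B' →ₐ[R] T') (hi : ∀ a, i (algebraMap A A' a) = algebraMap T T' (algebraMap A T a))
    (hj : ∀ b, j (algebraMap B B' b) = algebraMap T T' (algebraMap B T b)) :
    Function.Injective (Algebra.TensorProduct.productMap i j) := by
  let ι : A ⊗[R] B →ₐ[R] A' ⊗[R] B' :=
    Algebra.TensorProduct.map (IsScalarTower.toAlgHom R A A') (IsScalarTower.toAlgHom R B B')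
  have hu : IsUnit (ι (f ⊗ₜ g)) := by
    have : ι (f ⊗ₜ g) = (algebraMap A A' f ⊗ₜ 1) * (1 ⊗ₜ algebraMap B B' g) := by
      simp [ι]
    rw [this]
    exact ((IsLocalization.Away.algebraMap_isUnit f).map
      (Algebra.TensorProduct.includeLeft : A' →ₐ[R] A' ⊗[R] B')).mul
      ((IsLocalization.Away.algebraMap_isUnit g).map
      (Algebra.TensorProduct.includeRight : B' →ₐ[R] A' ⊗[R] B'))
  have hden (z : A' ⊗[R] B') : ∃ n w, ι (f ⊗ₜ g) ^ n * z = ι w := by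
    induction z with
    | zero => exact ⟨0, 0, by simp⟩
    | add x y hx hy =>
      obtain ⟨n, v, hv⟩ := hx
      obtain ⟨m, w, hw⟩ := hy
      refine ⟨n + m, (f ⊗ₜ g) ^ m * v + (f ⊗ₜ g) ^ n * w, ?_⟩
      rw [map_add, map_mul, map_mul, ← hv, ← hw, map_pow, map_pow]
      ring
    | tmul x y =>
      obtain ⟨n, a, ha⟩ := IsLocalization.Away.surj f x
      obtain ⟨m, b, hb⟩ := IsLocalization.Away.surj g y
      refine ⟨n + m, (f ^ m * a) ⊗ₜ (g ^ n * b), ?_⟩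
      simp only [ι, Algebra.TensorProduct.map_tmul, IsScalarTower.coe_toAlgHom',
        Algebra.TensorProduct.tmul_pow, Algebra.TensorProduct.tmul_mul_tmul, map_mul, map_pow,
        ← ha, ← hb]
      congr 1 <;> ring
  have hcomp (w : A ⊗[R] B) : Algebra.TensorProduct.productMap i j (ι w) =
      algebraMap T T' (Algebra.IsPushout.equiv R A B T w) := by
    induction w with
    | zero => simp
    | add x y hx hy => simp [hx, hy]
    | tmul x y => simp [ι, Algebra.IsPushout.equiv_tmul, hi, hj]
  rw [injective_iff_map_eq_zero]
  intro z hz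
  obtain ⟨n, w, hw⟩ := hden z
  have h1 := hcomp w
  rw [← hw, map_mul, hz, mul_zero] at h1
  obtain ⟨⟨_, m, rfl⟩, hm⟩ := (IsLocalization.map_eq_zero_iff
    (Submonoid.powers (algebraMap A T f * algebraMap B T g)) _ _).1 h1.symm
  have h2 : (f ⊗ₜ[R] g) ^ m * w = 0 := by
    apply (Algebra.IsPushout.equiv R A B T).injective
    rw [map_mul, map_pow, Algebra.IsPushout.equiv_tmul, map_zero]
    exact hm
  have h3 := congr(ι $h2)
  rw [map_mul, ← hw, map_zero, map_pow] at h3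
  exact (hu.pow n).mul_left_cancel ((hu.pow m).mul_left_cancel (by simpa using h3))

end Pushout

/-! ### The Bernstein-Sato polynomial of `f ⊗ g` -/

section Tensor

open TensorProduct

attribute [local instance] Polynomial.algebra

variable {A B T : Type*} [CommRing A] [CommRing B] [CommRing T] [Algebra ℂ A] [Algebra ℂ B]
  [Algebra ℂ T] [Algebra A T] [Algebra B T] [IsScalarTower ℂ A T] [IsScalarTower ℂ B T]
  {f : A} {g : B} {h : T}

/-- The map `A_f[s] → T_h[s]` when `h` is a multiple of the image of `f`. -/
noncomputable def awayMapPolynomial {v : T} (hv : h = algebraMap A T f * v) :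
    (Localization.Away f)[X] →ₐ[ℂ[X]] (Localization.Away h)[X] where
  __ := mapRingHom (awayMap (algebraMap A T) hv)
  commutes' b := by
    change (b.map (algebraMap ℂ _)).map (awayMap (algebraMap A T) hv) = b.map (algebraMap ℂ _)
    rw [Polynomial.map_map]
    congr 1
    ext c
    exact awayMap_algebraMap_complex hv c

theorem awayMapPolynomial_apply {v : T} (hv : h = algebraMap A T f * v)
    (x : (Localization.Away f)[X]) :
    awayMapPolynomial hv x = x.map (awayMap (algebraMap A T) hv) := rfl

theorem awayMapPolynomial_map {v : T} (hv : h = algebraMap A T f * v) (q : A[X]) :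
    awayMapPolynomial hv (q.map (algebraMap A (Localization.Away f))) =
      (q.map (algebraMap A T)).map (algebraMap T (Localization.Away h)) := by
  rw [awayMapPolynomial_apply, Polynomial.map_map, Polynomial.map_map]
  congr 1
  ext a
  exact awayMap_algebraMap _ hv a

/-- A derivation of `A`, extended by zero on `B`, acts on `f^s g^s` through the factor `f^s`. -/
theorem derivationAction_mul_of_extends (hA : h = algebraMap A T f * algebraMap B T g)
    (hB : h = algebraMap B T g * algebraMap A T f) {δ : Derivation ℂ A A} {d : Derivation ℂ T T}
    (hd : ∀ a, d (algebraMap A T a) = algebraMap A T (δ a)) (hd' : ∀ b, d (algebraMap B T b) = 0)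
    (x : (Localization.Away f)[X]) (y : (Localization.Away g)[X]) :
    derivationAction h d (awayMapPolynomial hA x * awayMapPolynomial hB y) =
      awayMapPolynomial hA (derivationAction f δ x) * awayMapPolynomial hB y := by
  have h1 : coeffwise (localizedDerivation h d) (awayMapPolynomial hB y) = 0 := by
    rw [awayMapPolynomial_apply, map_coeffwise (awayMap (algebraMap B T) hB) 0]
    · ext n
      simp [coeff_coeffwise]
    · refine map_derivation_of_isLocalization (Submonoid.powers g) _ _ _ fun b => ?_
      rw [awayMap_algebraMap, localizedDerivation_algebraMap, hd', Derivation.zero_apply,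
        map_zero, map_zero]
  have h2 := derivationAction_map (w := 0) (algebraMap A T) (awayMap (algebraMap A T) hA)
    (awayMap_algebraMap _ hA) hA δ d hd (by rw [hd', zero_mul]) x
  rw [map_zero, C_0, mul_zero, zero_mul, add_zero] at h2
  rw [mul_comm, derivationAction_mul, h1, zero_mul, zero_add, awayMapPolynomial_apply hA, h2,
    mul_comm]
  rfl

/-- The multiplication `A_f[s] × B_g[s] → T_h[s]` for `h = f g`. -/
noncomputable def mulAway (hA : h = algebraMap A T f * algebraMap B T g)
    (hB : h = algebraMap B T g * algebraMap A T f) :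
    (Localization.Away f)[X] →ₗ[ℂ[X]] (Localization.Away g)[X] →ₗ[ℂ[X]] (Localization.Away h)[X] :=
  (LinearMap.mul ℂ[X] (Localization.Away h)[X]).compl₁₂ (awayMapPolynomial hA).toLinearMap
    (awayMapPolynomial hB).toLinearMap

theorem mulAway_apply (hA : h = algebraMap A T f * algebraMap B T g)
    (hB : h = algebraMap B T g * algebraMap A T f) (x : (Localization.Away f)[X])
    (y : (Localization.Away g)[X]) :
    mulAway hA hB x y = awayMapPolynomial hA x * awayMapPolynomial hB y := rfl

theorem isLocalization_C {A L : Type*} [CommRing A] [CommRing L] [Algebra A L] (f : A)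
    [IsLocalization.Away f L] : IsLocalization.Away (C f) L[X] := by
  have := Polynomial.isLocalization (Submonoid.powers f) L
  rwa [Submonoid.map_powers] at this

/-- `T[s] = A[s] ⊗ B[s]` over `ℂ[s]`, if `T = A ⊗ B` over `ℂ`. -/
theorem isPushout_polynomial [Algebra.IsPushout ℂ A B T] :
    Algebra.IsPushout ℂ[X] A[X] B[X] T[X] := by
  have : Algebra.IsPushout ℂ A[X] B T[X] :=
    (Algebra.IsPushout.comp_iff ℂ A B T).2 inferInstance
  exact (Algebra.IsPushout.comp_iff ℂ ℂ[X] B B[X]).1 this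

theorem lift_mulAway_injective [Algebra.IsPushout ℂ A B T]
    (hA : h = algebraMap A T f * algebraMap B T g)
    (hB : h = algebraMap B T g * algebraMap A T f) :
    Function.Injective (TensorProduct.lift (mulAway hA hB)) := by
  have := isPushout_polynomial (A := A) (B := B) (T := T)
  have := isLocalization_C (L := Localization.Away f) f
  have := isLocalization_C (L := Localization.Away g) g
  have : IsLocalization.Away (algebraMap A[X] T[X] (C f) * algebraMap B[X] T[X] (C g))
      (Localization.Away h)[X] := by
    have := isLocalization_C (L := Localization.Away h) h
    convert this
    simp [hA]
  have h1 := productMap_injective_of_isLocalization (R := ℂ[X]) (T := T[X]) (C f) (C g)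
    (awayMapPolynomial hA) (awayMapPolynomial hB) (awayMapPolynomial_map hA)
    (awayMapPolynomial_map hB)
  convert h1 using 1
  have : TensorProduct.lift (mulAway hA hB) = (Algebra.TensorProduct.productMap
    (awayMapPolynomial hA) (awayMapPolynomial hB)).toLinearMap := by
    ext x y
    rfl
  rw [this]
  rfl

/-- The inclusion `N_f · N_g ⊆ N_h`. -/
theorem mulAway_mem_cyclicModule [Algebra.IsPushout ℂ A B T]
    (hA : h = algebraMap A T f * algebraMap B T g)
    (hB : h = algebraMap B T g * algebraMap A T f) {x : (Localization.Away f)[X]}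
    {y : (Localization.Away g)[X]} (hx : x ∈ cyclicModule f) (hy : y ∈ cyclicModule g) :
    mulAway hA hB x y ∈ cyclicModule h := by
  have hT : Algebra.IsPushout ℂ B A T := Algebra.IsPushout.symm inferInstance
  refine cyclicModule_induction (p := fun x => mulAway hA hB x y ∈ cyclicModule h) ?_
    (fun x x' hx hx' => ?_) (fun q x hx => ?_) (fun δ x hx => ?_) hx
  · refine cyclicModule_induction (p := fun y => mulAway hA hB (C _) y ∈ cyclicModule h) ?_
      (fun y y' hy hy' => ?_) (fun q y hy => ?_) (fun δ y hy => ?_) hy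
    · convert C_mem_cyclicModule h using 1
      rw [mulAway_apply, awayMapPolynomial_apply, awayMapPolynomial_apply, Polynomial.map_C,
        Polynomial.map_C, awayMap_algebraMap, awayMap_algebraMap, ← C_mul, ← map_mul, ← hA]
    · rw [map_add]
      exact add_mem hy hy'
    · rw [mulAway_apply, map_mul, awayMapPolynomial_map, mul_left_comm]
      exact map_mul_mem_cyclicModule _ hy
    · obtain ⟨d, hd, hd'⟩ := exists_derivation_extension_of_isPushout (B := A) (T := T) δ
      rw [mulAway_apply, mul_comm, ← derivationAction_mul_of_extends hB hA hd hd', mul_comm]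
      exact derivationAction_mem_cyclicModule _ hy
  · rw [map_add, LinearMap.add_apply]
    exact add_mem hx hx'
  · rw [mulAway_apply, map_mul, awayMapPolynomial_map, mul_assoc]
    exact map_mul_mem_cyclicModule _ hx
  · obtain ⟨d, hd, hd'⟩ := exists_derivation_extension_of_isPushout (B := B) (T := T) δ
    rw [mulAway_apply, ← derivationAction_mul_of_extends hA hB hd hd']
    exact derivationAction_mem_cyclicModule _ hx

/-- An induction principle for `Submodule.map₂` which needs no compatibility with scalars. -/
theorem map₂_induction_add {R M N P : Type*} [CommSemiring R] [AddCommMonoid M] [AddCommMonoid N]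
    [AddCommMonoid P] [Module R M] [Module R N] [Module R P] (β : M →ₗ[R] N →ₗ[R] P)
    {p : Submodule R M} {q : Submodule R N} {C : P → Prop} (zero : C 0)
    (mem : ∀ m ∈ p, ∀ n ∈ q, C (β m n)) (add : ∀ x y, C x → C y → C (x + y)) {x : P}
    (hx : x ∈ Submodule.map₂ β p q) : C x := by
  refine Submodule.iSup_induction _ (motive := C) hx ?_ zero add
  rintro ⟨m, hm⟩ _ ⟨n, hn, rfl⟩
  exact mem m hm n hn

/-- The inclusion `N_h ⊆ N_f · N_g`. The right hand side is stable under the derivations of `T` because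
they are combinations of derivations of `A` and of `B`. -/
theorem mem_map₂_of_mem_cyclicModule [Algebra.IsPushout ℂ A B T]
    [Module.Projective A Ω[A⁄ℂ]] [Module.Finite A Ω[A⁄ℂ]]
    [Module.Projective B Ω[B⁄ℂ]] [Module.Finite B Ω[B⁄ℂ]]
    (hA : h = algebraMap A T f * algebraMap B T g)
    (hB : h = algebraMap B T g * algebraMap A T f) {z : (Localization.Away h)[X]}
    (hz : z ∈ cyclicModule h) :
    z ∈ Submodule.map₂ (mulAway hA hB) ((cyclicModule f).restrictScalars ℂ[X])
      ((cyclicModule g).restrictScalars ℂ[X]) := by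
  have hT : Algebra.IsPushout ℂ B A T := Algebra.IsPushout.symm inferInstance
  set N := Submodule.map₂ (mulAway hA hB) ((cyclicModule f).restrictScalars ℂ[X])
      ((cyclicModule g).restrictScalars ℂ[X]) with hN
  have hmem {x y} (hx : x ∈ cyclicModule f) (hy : y ∈ cyclicModule g) : mulAway hA hB x y ∈ N :=
    Submodule.apply_mem_map₂ _ hx hy
  have hmulA (q : A[X]) {z} (hz : z ∈ N) :
      (q.map (algebraMap A T)).map (algebraMap T (Localization.Away h)) * z ∈ N := by
    refine map₂_induction_add _ (C := fun z => _ * z ∈ N) ?_ (fun x hx y hy => ?_)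
      (fun x y hx hy => ?_) hz
    · simp
    · rw [mulAway_apply, ← mul_assoc, ← awayMapPolynomial_map hA, ← map_mul]
      exact hmem (map_mul_mem_cyclicModule _ hx) hy
    · rw [mul_add]
      exact add_mem hx hy
  have hmulB (q : B[X]) {z} (hz : z ∈ N) :
      (q.map (algebraMap B T)).map (algebraMap T (Localization.Away h)) * z ∈ N := by
    refine map₂_induction_add _ (C := fun z => _ * z ∈ N) ?_ (fun x hx y hy => ?_)
      (fun x y hx hy => ?_) hz
    · simp
    · rw [mulAway_apply, mul_left_comm, ← awayMapPolynomial_map hB, ← map_mul]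
      exact hmem hx (map_mul_mem_cyclicModule _ hy)
    · rw [mul_add]
      exact add_mem hx hy
  have hmul (q : T[X]) {z} (hz : z ∈ N) : q.map (algebraMap T (Localization.Away h)) * z ∈ N := by
    have := isPushout_polynomial (A := A) (B := B) (T := T)
    induction q using this.out.inductionOn with
    | zero => simp
    | add x y hx hy =>
      rw [Polynomial.map_add, add_mul]
      exact add_mem hx hy
    | tmul b => exact hmulB b hz
    | smul a x hx =>
      rw [Algebra.smul_def, Polynomial.map_mul, mul_assoc]
      exact hmulA a hx
  refine cyclicModule_induction (p := fun z => z ∈ N) ?_ (fun _ _ => add_mem)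
    (fun q z hz => hmul q hz) (fun d z hz => ?_) hz
  · convert hmem (C_mem_cyclicModule f) (C_mem_cyclicModule g) using 1
    rw [mulAway_apply, awayMapPolynomial_apply, awayMapPolynomial_apply, Polynomial.map_C,
      Polynomial.map_C, awayMap_algebraMap, awayMap_algebraMap, ← C_mul, ← map_mul, ← hA]
  · have hd : d ∈ Submodule.span T (extendedDerivations A B T ∪ extendedDerivations B A T) := by
      rw [span_extendedDerivations]
      trivial
    induction hd using Submodule.span_induction with
    | mem d hd =>
      refine map₂_induction_add _ (C := fun z => derivationAction h d z ∈ N) ?_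
        (fun x hx y hy => ?_) (fun x y hx hy => ?_) hz
      · rw [map_zero]
        exact zero_mem _
      · rcases hd with ⟨δ, hd, hd'⟩ | ⟨δ, hd, hd'⟩
        · rw [mulAway_apply, derivationAction_mul_of_extends hA hB hd hd']
          exact hmem (derivationAction_mem_cyclicModule _ hx) hy
        · rw [mulAway_apply, mul_comm, derivationAction_mul_of_extends hB hA hd hd', mul_comm]
          exact hmem hx (derivationAction_mem_cyclicModule _ hy)
      · rw [map_add]
        exact add_mem hx hy
    | zero =>
      have := derivationAction_smul h 0 0 z
      rw [zero_smul, Polynomial.map_C, map_zero, C_0, zero_mul] at this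
      rw [this]
      exact zero_mem _
    | add d e _ _ hd he =>
      rw [derivationAction_add]
      exact add_mem hd he
    | smul t d _ hd =>
      rw [derivationAction_smul]
      exact hmul _ hd

theorem exists_linearMap_one {L : Type*} [CommRing L] [Algebra ℂ L] [Nontrivial L] :
    ∃ φ : L[X] →ₗ[ℂ[X]] ℂ[X], φ 1 = 1 := by
  obtain ⟨ψ, hψ⟩ := Module.Projective.exists_dual_ne_zero ℂ (one_ne_zero : (1 : L) ≠ 0)
  have h : Algebra.IsPushout ℂ ℂ[X] L L[X] := inferInstance
  have h1 : h.out.lift (Algebra.linearMap ℂ ℂ[X] ∘ₗ ψ) 1 = C (ψ 1) := by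
    have := h.out.lift_eq (Algebra.linearMap ℂ ℂ[X] ∘ₗ ψ) 1
    simpa using this
  refine ⟨C (ψ 1)⁻¹ • h.out.lift (Algebra.linearMap ℂ ℂ[X] ∘ₗ ψ), ?_⟩
  rw [LinearMap.smul_apply, h1, smul_eq_mul, ← C_mul, inv_mul_cancel₀ hψ, C_1]

theorem isTorsionFree_polynomial {L : Type*} [CommRing L] [Algebra ℂ L] :
    Module.IsTorsionFree ℂ[X] L[X] := by
  have h : Algebra.IsPushout ℂ ℂ[X] L L[X] := inferInstance
  have := Module.Flat.isBaseChange ℂ ℂ[X] L L[X] h.out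
  infer_instance

theorem smul_one_mem_cyclicModule_iff (f : A) (b : ℂ[X]) :
    b • (1 : (Localization.Away f)[X]) ∈ (cyclicModule f).restrictScalars ℂ[X] ↔
      bernsteinSatoPolynomial f ∣ b := by
  rw [bernsteinSatoPolynomial_dvd_iff, mem_functionalIdeal_iff, Algebra.smul_def, mul_one]
  rfl

/-- The theorem for affine varieties with divisors given by single equations. -/
theorem bernsteinSatoPolynomial_mul [Algebra.IsPushout ℂ A B T]
    [Module.Projective A Ω[A⁄ℂ]] [Module.Finite A Ω[A⁄ℂ]]
    [Module.Projective B Ω[B⁄ℂ]] [Module.Finite B Ω[B⁄ℂ]]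
    [Nontrivial (Localization.Away f)] [Nontrivial (Localization.Away g)]
    (hA : h = algebraMap A T f * algebraMap B T g) :
    bernsteinSatoPolynomial h = bernsteinSatoPolynomial f * bernsteinSatoPolynomial g := by
  have hB : h = algebraMap B T g * algebraMap A T f := by rw [hA, mul_comm]
  have h1 : mulAway hA hB 1 1 = 1 := by rw [mulAway_apply, map_one, map_one, mul_one]
  refine dvd_antisymm_of_normalize_eq ?_ ?_ ?_ ?_
  · simp [bernsteinSatoPolynomial]
  · simp [bernsteinSatoPolynomial]
  · rw [← smul_one_mem_cyclicModule_iff, ← h1, mul_smul, ← LinearMap.map_smul, ← LinearMap.map_smul₂]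
    exact mulAway_mem_cyclicModule hA hB ((smul_one_mem_cyclicModule_iff _ _).2 dvd_rfl)
      ((smul_one_mem_cyclicModule_iff _ _).2 dvd_rfl)
  · obtain ⟨φ₁, hφ₁⟩ := exists_linearMap_one (L := Localization.Away f)
    obtain ⟨φ₂, hφ₂⟩ := exists_linearMap_one (L := Localization.Away g)
    have := isTorsionFree_polynomial (L := Localization.Away f)
    have := isTorsionFree_polynomial (L := Localization.Away g)
    refine mul_dvd_of_smul_mem_map₂ (mulAway hA hB) (lift_mulAway_injective hA hB) hφ₁ hφ₂
      (smul_one_mem_cyclicModule_iff f) (smul_one_mem_cyclicModule_iff g) ?_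
    rw [h1]
    exact mem_map₂_of_mem_cyclicModule hA hB ((smul_one_mem_cyclicModule_iff h _).2 dvd_rfl)

end Tensor

/-! ### Divisors on schemes -/

section Schemes

theorem smooth_sectionsAlgebra {X : Scheme.{0}} (p : X ⟶ Spec (.of ℂ)) [Smooth p]
    (U : X.affineOpens) : letI := sectionsAlgebra p U.1; Algebra.Smooth ℂ Γ(X, U.1) := by
  have h1 : (p.appLE ⊤ U.1 le_top).hom.Smooth := p.smooth_appLE (isAffineOpen_top _) U.2 le_top
  have h2 : (Scheme.ΓSpecIso (.of ℂ)).inv.hom.Smooth :=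
    RingHom.Smooth.of_bijective (ConcreteCategory.bijective_of_isIso (Scheme.ΓSpecIso (.of ℂ)).inv)
  exact RingHom.Smooth.comp h2 h1

theorem exists_unit_of_span_eq {A : Type*} [CommRing A] {x y : A} (hx : x ∈ nonZeroDivisors A)
    (h : Ideal.span {x} = Ideal.span {y}) : ∃ u : Aˣ, y = x * u := by
  obtain ⟨c, hc⟩ := Ideal.mem_span_singleton.1 (h ▸ Ideal.mem_span_singleton_self x)
  obtain ⟨d, hd⟩ := Ideal.mem_span_singleton.1 (h ▸ Ideal.mem_span_singleton_self y)
  have : d * c = 1 := by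
    refine (mul_cancel_left_mem_nonZeroDivisors hx).1 ?_
    rw [← mul_assoc, ← hd, ← hc, mul_one]
  exact ⟨⟨d, c, this, by rw [mul_comm, this]⟩, hd⟩

variable {X : Scheme.{0}} (p : X ⟶ Spec (.of ℂ))

theorem EffectiveCartierDivisor.IsLocalEquation.restrict {D : EffectiveCartierDivisor X}
    {U : X.affineOpens} {f : Γ(X, U.1)} (hf : D.IsLocalEquation U f) (V : X.affineOpens)
    (i : V.1 ≤ U.1) : D.IsLocalEquation V ((X.presheaf.map (homOfLE i).op).hom f) := by
  refine ⟨?_, ?_⟩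
  · have h : (𝟙 X : X ⟶ X).appLE U.1 V.1 i = X.presheaf.map (homOfLE i).op := by
      simp only [Scheme.Hom.appLE, Scheme.Hom.id_app]
      exact Category.id_comp _
    rw [← h]
    exact appLE_mem_nonZeroDivisors (𝟙 X) U V i hf.1
  · rw [← D.idealSheaf.map_ideal i, hf.2, Ideal.map_span, Set.image_singleton]
    rfl

/-- Local equations of the same divisor differ by a unit. -/
theorem exists_unit_of_le {D : EffectiveCartierDivisor X}
    {U : X.affineOpens} {f : Γ(X, U.1)} (hf : D.IsLocalEquation U f) {V : X.affineOpens}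
    {f' : Γ(X, V.1)} (hf' : D.IsLocalEquation V f') (i : V.1 ≤ U.1) :
    ∃ u : Γ(X, V.1)ˣ, f' = (X.presheaf.map (homOfLE i).op).hom f * u :=
  exists_unit_of_span_eq (hf.restrict V i).1 ((hf.restrict V i).2.symm.trans hf'.2)

theorem sectionsAlgebra_isScalarTower {U V : X.Opens} (i : V ≤ U) :
    letI := sectionsAlgebra p U
    letI := sectionsAlgebra p V
    letI := (X.presheaf.map (homOfLE i).op).hom.toAlgebra
    IsScalarTower ℂ Γ(X, U) Γ(X, V) := by
  let := sectionsAlgebra p U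
  let := sectionsAlgebra p V
  let := (X.presheaf.map (homOfLE i).op).hom.toAlgebra
  refine IsScalarTower.of_algebraMap_eq' ?_
  simp only [RingHom.algebraMap_toAlgebra]
  have h := Scheme.Hom.appLE_map p (U := ⊤) (V := U) le_top (homOfLE i).op
  exact congr(((Scheme.ΓSpecIso (.of ℂ)).inv ≫ $h).hom).symm

theorem bernsteinSatoPolynomial_dvd_of_basicOpen {D : EffectiveCartierDivisor X}
    {U V : X.affineOpens} {f : Γ(X, U.1)} (hf : D.IsLocalEquation U f)
    {f' : Γ(X, V.1)} (hf' : D.IsLocalEquation V f') (a : Γ(X, U.1)) (ha : V.1 = X.basicOpen a)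
    {c : ℂ[X]} (hc : (letI := sectionsAlgebra p U.1; bernsteinSatoPolynomial f) ∣ c) :
    (letI := sectionsAlgebra p V.1; bernsteinSatoPolynomial f') ∣ c := by
  have i : V.1 ≤ U.1 := ha.trans_le (X.basicOpen_le a)
  let := sectionsAlgebra p U.1
  let := sectionsAlgebra p V.1
  let := (X.presheaf.map (homOfLE i).op).hom.toAlgebra
  have := sectionsAlgebra_isScalarTower p i
  have : IsLocalization.Away a Γ(X, V.1) := U.2.isLocalization_of_eq_basicOpen a (homOfLE i) ha
  have : Algebra.FormallyEtale Γ(X, U.1) Γ(X, V.1) :=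
    Algebra.FormallyEtale.of_isLocalization (Submonoid.powers a)
  obtain ⟨u, hu⟩ := exists_unit_of_le hf hf' i
  rw [bernsteinSatoPolynomial_dvd_iff] at hc ⊢
  exact functionalIdeal_le hu hc

/-- A functional equation on the basic open subset of `a` gives one on `U` up to a power of `a`. -/
theorem exists_pow_mul_mem_of_basicOpen [Smooth p] {D : EffectiveCartierDivisor X}
    {U V : X.affineOpens} {f : Γ(X, U.1)} (hf : D.IsLocalEquation U f)
    {f' : Γ(X, V.1)} (hf' : D.IsLocalEquation V f') (a : Γ(X, U.1)) (ha : V.1 = X.basicOpen a)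
    {c : ℂ[X]} (hc : (letI := sectionsAlgebra p V.1; bernsteinSatoPolynomial f') ∣ c) :
    letI := sectionsAlgebra p U.1
    ∃ k, C (algebraMap Γ(X, U.1) (Localization.Away f) a) ^ k *
      c.map (algebraMap ℂ (Localization.Away f)) ∈ cyclicModule f := by
  have i : V.1 ≤ U.1 := ha.trans_le (X.basicOpen_le a)
  let := sectionsAlgebra p U.1
  let := sectionsAlgebra p V.1
  let := (X.presheaf.map (homOfLE i).op).hom.toAlgebra
  have := sectionsAlgebra_isScalarTower p i
  have : IsLocalization.Away a Γ(X, V.1) := U.2.isLocalization_of_eq_basicOpen a (homOfLE i) ha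
  have := smooth_sectionsAlgebra p U
  obtain ⟨u, hu⟩ := exists_unit_of_le hf hf' i
  rw [bernsteinSatoPolynomial_dvd_iff] at hc
  exact exists_pow_mul_mem_cyclicModule a hu hc

/-- The Bernstein-Sato polynomial of a divisor can be computed on an affine open cover. -/
theorem EffectiveCartierDivisor.bernsteinSatoPolynomial_dvd_of_cover [Smooth p]
    (D : EffectiveCartierDivisor X) (c : ℂ[X])
    (h : ∀ x : X, ∃ (U : X.affineOpens) (f : Γ(X, U.1)), x ∈ U.1 ∧ D.IsLocalEquation U f ∧
      (letI := sectionsAlgebra p U.1; BernsteinSato.bernsteinSatoPolynomial f) ∣ c) :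
    D.bernsteinSatoPolynomial p ∣ c := by
  rw [EffectiveCartierDivisor.bernsteinSatoPolynomial_dvd_iff]
  intro W w hw
  let := sectionsAlgebra p W.1
  rw [BernsteinSato.bernsteinSatoPolynomial_dvd_iff]
  have hloc (x : W.1) : ∃ a : Γ(X, W.1), x.1 ∈ X.basicOpen a ∧
      ∃ k, C (algebraMap Γ(X, W.1) (Localization.Away w) a) ^ k *
        c.map (algebraMap ℂ (Localization.Away w)) ∈ cyclicModule w := by
    obtain ⟨U, f, hxU, hf, hc⟩ := h x.1
    obtain ⟨a, b, hab, hx⟩ := exists_basicOpen_le_affine_inter W.2 U.2 x.1 ⟨x.2, hxU⟩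
    let V : X.affineOpens := ⟨X.basicOpen a, W.2.basicOpen a⟩
    have hV : D.IsLocalEquation V _ := hw.restrict V (X.basicOpen_le a)
    exact ⟨a, hx, exists_pow_mul_mem_of_basicOpen p hw hV a rfl
      (bernsteinSatoPolynomial_dvd_of_basicOpen p hf hV b hab hc)⟩
  choose a hxa hk using hloc
  refine mem_functionalIdeal_of_span_eq_top (S := Set.range a) ?_ ?_
  · rw [← W.2.iSup_basicOpen_eq_self_iff]
    refine le_antisymm (iSup_le fun a => X.basicOpen_le _) fun x hx => ?_
    exact TopologicalSpace.Opens.mem_iSup.2 ⟨⟨a ⟨x, hx⟩, ⟨x, hx⟩, rfl⟩, hxa ⟨x, hx⟩⟩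
  · rintro _ ⟨x, rfl⟩
    exact hk x

variable {X₁ X₂ : Scheme.{0}} (p₁ : X₁ ⟶ Spec (.of ℂ)) (p₂ : X₂ ⟶ Spec (.of ℂ))

/-- The ring of functions on `U × V` is the tensor product of those on `U` and on `V`. -/
theorem isPushout_sections (U : X₁.affineOpens) (V : X₂.affineOpens)
    (W : (pullback p₁ p₂).affineOpens)
    (hW : W.1 = (pullback.fst p₁ p₂ ⁻¹ᵁ U.1) ⊓ (pullback.snd p₁ p₂ ⁻¹ᵁ V.1)) :
    IsPushout ((Scheme.ΓSpecIso (.of ℂ)).inv ≫ p₁.appLE ⊤ U.1 le_top)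
      ((Scheme.ΓSpecIso (.of ℂ)).inv ≫ p₂.appLE ⊤ V.1 le_top)
      ((pullback.fst p₁ p₂).appLE U.1 W.1 (hW.trans_le inf_le_left))
      ((pullback.snd p₁ p₂).appLE V.1 W.1 (hW.trans_le inf_le_right)) := by
  have h1 := isIso_pushoutSection_of_isAffineOpen (IsPullback.of_hasPullback p₁ p₂)
    (US := ⊤) (UT := V.1) (UX := U.1) le_top le_top hW (isAffineOpen_top _) V.2 U.2
  exact IsPushout.of_iso ((isIso_pushoutSection_iff _ _ _ _).1 h1) (Scheme.ΓSpecIso (.of ℂ)) (.refl _) (.refl _) (.refl _) (by simp)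
    (by simp) (by simp) (by simp)

theorem nontrivial_localizationAway {A : Type*} [CommRing A] [Nontrivial A] {f : A}
    (hf : f ∈ nonZeroDivisors A) : Nontrivial (Localization.Away f) :=
  (IsLocalization.injective (Localization.Away f)
    (M := Submonoid.powers f) (Submonoid.powers_le.2 hf)).nontrivial

/-- On a product of nonempty affine open subsets, `D₁ ⊗ D₂` has an equation whose Bernstein-Sato
polynomial is the product of those of the equations of `D₁` and `D₂`. For empty `U` this fails, as
`b_f = 1` and `U × V` is empty while `b_g` is arbitrary. -/
theorem exists_isLocalEquation_tensor [Smooth p₁] [Smooth p₂] {D₁ : EffectiveCartierDivisor X₁}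
    {D₂ : EffectiveCartierDivisor X₂} {U : X₁.affineOpens} {V : X₂.affineOpens}
    {f : Γ(X₁, U.1)} {g : Γ(X₂, V.1)} (hf : D₁.IsLocalEquation U f)
    (hg : D₂.IsLocalEquation V g) (hU : (U.1 : Set X₁).Nonempty) (hV : (V.1 : Set X₂).Nonempty) :
    ∃ (W : (pullback p₁ p₂).affineOpens) (h : Γ(pullback p₁ p₂, W.1)),
      W.1 = (pullback.fst p₁ p₂ ⁻¹ᵁ U.1) ⊓ (pullback.snd p₁ p₂ ⁻¹ᵁ V.1) ∧
      (EffectiveCartierDivisor.tensor p₁ p₂ D₁ D₂).IsLocalEquation W h ∧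
      (letI := sectionsAlgebra (pullback.fst p₁ p₂ ≫ p₁) W.1; bernsteinSatoPolynomial h) =
        (letI := sectionsAlgebra p₁ U.1; bernsteinSatoPolynomial f) *
          (letI := sectionsAlgebra p₂ V.1; bernsteinSatoPolynomial g) := by
  have hWaff : IsAffineOpen
      ((pullback.fst p₁ p₂ ⁻¹ᵁ U.1) ⊓ (pullback.snd p₁ p₂ ⁻¹ᵁ V.1)) := by
    have : IsAffine U.1 := U.2
    have : IsAffine V.1 := V.2
    have : IsAffine (⊤ : (Spec (.of ℂ)).Opens) := isAffineOpen_top _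
    exact .of_isIso (Scheme.Hom.isPullback_resLE (IsPullback.of_hasPullback p₁ p₂)
      (US := ⊤) (UT := V.1) (UX := U.1) le_top le_top rfl).isoPullback.hom
  let W : (pullback p₁ p₂).affineOpens := ⟨_, hWaff⟩
  refine ⟨W, _, rfl, EffectiveCartierDivisor.tensor_isLocalEquation p₁ p₂ D₁ D₂ hf hg W rfl, ?_⟩
  let := sectionsAlgebra p₁ U.1
  let := sectionsAlgebra p₂ V.1
  let := sectionsAlgebra (pullback.fst p₁ p₂ ≫ p₁) W.1
  let := ((pullback.fst p₁ p₂).appLE U.1 W.1 inf_le_left).hom.toAlgebra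
  let := ((pullback.snd p₁ p₂).appLE V.1 W.1 inf_le_right).hom.toAlgebra
  have : IsScalarTower ℂ Γ(X₁, U.1) Γ(pullback p₁ p₂, W.1) := by
    refine IsScalarTower.of_algebraMap_eq' ?_
    have h2 := Scheme.Hom.appLE_comp_appLE (pullback.fst p₁ p₂) p₁ ⊤ U.1 W.1 le_top inf_le_left
    exact congr(((Scheme.ΓSpecIso (.of ℂ)).inv ≫ $h2).hom).symm
  have : IsScalarTower ℂ Γ(X₂, V.1) Γ(pullback p₁ p₂, W.1) := by
    refine IsScalarTower.of_algebraMap_eq' ?_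
    have h2 := Scheme.Hom.appLE_comp_appLE (pullback.snd p₁ p₂) p₂ ⊤ V.1 W.1 le_top inf_le_right
    simp only [← pullback.condition] at h2
    exact congr(((Scheme.ΓSpecIso (.of ℂ)).inv ≫ $h2).hom).symm
  have : Algebra.IsPushout ℂ Γ(X₁, U.1) Γ(X₂, V.1) Γ(pullback p₁ p₂, W.1) :=
    CommRingCat.isPushout_iff_isPushout.1 (isPushout_sections p₁ p₂ U V W rfl)
  have := smooth_sectionsAlgebra p₁ U
  have := smooth_sectionsAlgebra p₂ V
  have : Nonempty U.1 := hU.to_subtype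
  have : Nonempty V.1 := hV.to_subtype
  have := nontrivial_localizationAway hf.1
  have := nontrivial_localizationAway hg.1
  exact bernsteinSatoPolynomial_mul rfl

/-- Over the zero ring the Bernstein-Sato polynomial is `1`. -/
theorem bernsteinSatoPolynomial_dvd_of_subsingleton {A : Type*} [CommRing A] [Algebra ℂ A]
    [Subsingleton A] (f : A) (c : ℂ[X]) : bernsteinSatoPolynomial f ∣ c := by
  have : Subsingleton (Localization.Away f) :=
    (algebraMap A (Localization.Away f)).codomain_trivial
  rw [bernsteinSatoPolynomial_dvd_iff, mem_functionalIdeal_iff,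
    Subsingleton.elim (c.map _) 0]
  exact zero_mem _

/-- To check divisibility by `b_D` it is enough to look at nonempty affine open subsets. -/
theorem EffectiveCartierDivisor.bernsteinSatoPolynomial_dvd_of_nonempty
    (D : EffectiveCartierDivisor X) {c : ℂ[X]}
    (h : ∀ (U : X.affineOpens) (f : Γ(X, U.1)), (U.1 : Set X).Nonempty → D.IsLocalEquation U f →
      (letI := sectionsAlgebra p U.1; BernsteinSato.bernsteinSatoPolynomial f) ∣ c) :
    D.bernsteinSatoPolynomial p ∣ c := by
  rw [EffectiveCartierDivisor.bernsteinSatoPolynomial_dvd_iff]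
  intro U f hf
  rcases (U.1 : Set X).eq_empty_or_nonempty with hU | hU
  · have hU' : U.1 = ⊥ := TopologicalSpace.Opens.ext hU
    have : Subsingleton Γ(X, U.1) := by
      rw [hU']
      infer_instance
    let := sectionsAlgebra p U.1
    exact bernsteinSatoPolynomial_dvd_of_subsingleton f c
  · exact h U f hU hf

theorem EffectiveCartierDivisor.exists_nonempty_isLocalEquation [Nonempty X]
    (D : EffectiveCartierDivisor X) : ∃ (U : X.affineOpens) (f : Γ(X, U.1)),
      (U.1 : Set X).Nonempty ∧ D.IsLocalEquation U f := by
  obtain ⟨U, hU, f, hf⟩ := D.exists_isLocalEquation (Classical.arbitrary X)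
  exact ⟨U, f, ⟨_, hU⟩, hf⟩

theorem bernsteinSatoPolynomial_tensor_dvd [Smooth p₁] [Smooth p₂]
    (D₁ : EffectiveCartierDivisor X₁) (D₂ : EffectiveCartierDivisor X₂) :
    (EffectiveCartierDivisor.tensor p₁ p₂ D₁ D₂).bernsteinSatoPolynomial
        (pullback.fst p₁ p₂ ≫ p₁) ∣
      D₁.bernsteinSatoPolynomial p₁ * D₂.bernsteinSatoPolynomial p₂ := by
  refine EffectiveCartierDivisor.bernsteinSatoPolynomial_dvd_of_cover _ _ _ fun x => ?_
  obtain ⟨U, hxU, f, hf⟩ := D₁.exists_isLocalEquation (pullback.fst p₁ p₂ x)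
  obtain ⟨V, hxV, g, hg⟩ := D₂.exists_isLocalEquation (pullback.snd p₁ p₂ x)
  obtain ⟨W, h, hW, hh, hmul⟩ :=
    exists_isLocalEquation_tensor p₁ p₂ hf hg ⟨_, hxU⟩ ⟨_, hxV⟩
  refine ⟨W, h, hW.ge ⟨hxU, hxV⟩, hh, ?_⟩
  rw [hmul]
  exact mul_dvd_mul
    ((EffectiveCartierDivisor.bernsteinSatoPolynomial_dvd_iff p₁ D₁ _).1 dvd_rfl U f hf)
    ((EffectiveCartierDivisor.bernsteinSatoPolynomial_dvd_iff p₂ D₂ _).1 dvd_rfl V g hg)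

theorem mul_dvd_bernsteinSatoPolynomial_tensor [Nonempty X₁] [Nonempty X₂] [Smooth p₁] [Smooth p₂]
    (D₁ : EffectiveCartierDivisor X₁) (D₂ : EffectiveCartierDivisor X₂) :
    D₁.bernsteinSatoPolynomial p₁ * D₂.bernsteinSatoPolynomial p₂ ∣
      (EffectiveCartierDivisor.tensor p₁ p₂ D₁ D₂).bernsteinSatoPolynomial
        (pullback.fst p₁ p₂ ≫ p₁) := by
  set c := (EffectiveCartierDivisor.tensor p₁ p₂ D₁ D₂).bernsteinSatoPolynomial
    (pullback.fst p₁ p₂ ≫ p₁) with hc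
  by_cases hc0 : c = 0
  · simp [hc0]
  have hlocal {U : X₁.affineOpens} {V : X₂.affineOpens} {f : Γ(X₁, U.1)} {g : Γ(X₂, V.1)}
      (hU : (U.1 : Set X₁).Nonempty) (hV : (V.1 : Set X₂).Nonempty)
      (hf : D₁.IsLocalEquation U f) (hg : D₂.IsLocalEquation V g) :
      (letI := sectionsAlgebra p₁ U.1; bernsteinSatoPolynomial f) *
        (letI := sectionsAlgebra p₂ V.1; bernsteinSatoPolynomial g) ∣ c := by
    obtain ⟨W, h, -, hh, hmul⟩ := exists_isLocalEquation_tensor p₁ p₂ hf hg hU hV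
    rw [← hmul]
    exact (EffectiveCartierDivisor.bernsteinSatoPolynomial_dvd_iff _ _ c).1 dvd_rfl W h hh
  have hleft {U : X₁.affineOpens} {f : Γ(X₁, U.1)} (hU : (U.1 : Set X₁).Nonempty)
      (hf : D₁.IsLocalEquation U f) :
      (letI := sectionsAlgebra p₁ U.1; bernsteinSatoPolynomial f) *
        D₂.bernsteinSatoPolynomial p₂ ∣ c := by
    obtain ⟨V₀, g₀, hV₀, hg₀⟩ := D₂.exists_nonempty_isLocalEquation
    obtain ⟨d, hd⟩ := (dvd_mul_right _ _).trans (hlocal hU hV₀ hf hg₀)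
    rw [hd]
    refine mul_dvd_mul_left _ (D₂.bernsteinSatoPolynomial_dvd_of_nonempty p₂ fun V g hV hg => ?_)
    refine (mul_dvd_mul_iff_left (left_ne_zero_of_mul (hd ▸ hc0))).1 ?_
    rw [← hd]
    exact hlocal hU hV hf hg
  obtain ⟨U₀, f₀, hU₀, hf₀⟩ := D₁.exists_nonempty_isLocalEquation
  obtain ⟨d, hd⟩ := (dvd_mul_left _ _).trans (hleft hU₀ hf₀)
  rw [hd, mul_comm]
  refine mul_dvd_mul_left _ (D₁.bernsteinSatoPolynomial_dvd_of_nonempty p₁ fun U f hU hf => ?_)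
  refine (mul_dvd_mul_iff_left (left_ne_zero_of_mul (hd ▸ hc0))).1 ?_
  rw [← hd, mul_comm]
  exact hleft hU hf

end Schemes

end BernsteinSato
theorem theoremB
    {X₁ X₂ : AlgebraicGeometry.Scheme.{0}} [Nonempty X₁] [Nonempty X₂]
    (p₁ : X₁ ⟶ Spec (.of ℂ)) [Smooth p₁] [IsSeparated p₁] [QuasiCompact p₁]
    (p₂ : X₂ ⟶ Spec (.of ℂ)) [Smooth p₂] [IsSeparated p₂] [QuasiCompact p₂]
    (D₁ : BernsteinSato.EffectiveCartierDivisor X₁)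
    (D₂ : BernsteinSato.EffectiveCartierDivisor X₂) :
    (BernsteinSato.EffectiveCartierDivisor.tensor p₁ p₂ D₁ D₂).bernsteinSatoPolynomial
        (pullback.fst p₁ p₂ ≫ p₁) =
      D₁.bernsteinSatoPolynomial p₁ * D₂.bernsteinSatoPolynomial p₂ := by
  refine dvd_antisymm_of_normalize_eq ?_ ?_
    (BernsteinSato.bernsteinSatoPolynomial_tensor_dvd p₁ p₂ D₁ D₂)
    (BernsteinSato.mul_dvd_bernsteinSatoPolynomial_tensor p₁ p₂ D₁ D₂)
  · simp [BernsteinSato.EffectiveCartierDivisor.bernsteinSatoPolynomial]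
  · simp [BernsteinSato.EffectiveCartierDivisor.bernsteinSatoPolynomial]
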